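/- Let $\mathcal X_1,\mathcal X_2,\mathcal Y$ be finite alphabets ($\mathcal X_1,\mathcal X_2$ nonempty), let $P_{Y|X_1,X_2}$ be a memoryless channel, let $d_{min},d_{max}\ge 0$ be integers, $\mathcal D=\{-d_{min},\dots,d_{max}\}$ and $D=|\mathcal D|=d_{max}+d_{min}+1$. For block length $n$ and delay $d\in\mathcal D$ put $$P_d(\mathbf y|\mathbf x_1,\mathbf x_2)=\prod_{i=1}^n P_{Y|X_1,X_2}(y_i\,|\,x_{1,i-d},x_{2,i}),$$ where the symbols $x_{1,i-d}$ with $i-d\notin\{1,\dots,n\}$ are arbitrary: they are supplied by a filling rule $\sigma$, which may depend on $n,d,\mathbf x_1,\mathbf x_2$ and the position. Fix any nonempty set $S$ of filling rules (one rule is a fixed convention; all rules is the worst case). For $R_1,R_2\ge 0$ let $\mathcal M_j=\{1,\dots,\lceil 2^{nR_j}\rceil\}$. An ACC-MAC code of length $n$ consists of deterministic maps $f_1:\mathcal M_1\to\mathcal X_1^n$, $f_2:\mathcal X_1^n\times\mathcal M_2\to\mathcal X_2^n$ (the informed encoder knows only the codeword) and $g:\mathcal Y^n\to\mathcal M_1\times\mathcal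 M_2$. Its error probability for delay $d$ is $$\bar P_{e,d}=\frac1{|\mathcal M_1||\mathcal M_2|}\sum_{m_1,m_2}\ \sum_{\mathbf y:\,g(\mathbf y)\ne(m_1,m_2)}P_d\big(\mathbf y\,|\,f_1(m_1),f_2(f_1(m_1),m_2)\big).$$ The pair $(R_1,R_2)$ is achievable if there are codes of each length $n$ and $\epsilon_n\to0$ such that $\bar P_{e,d}\le\epsilon_n$ for all $n$, all $d\in\mathcal D$ and all rules in $S$. The capacity region $\mathcal C_{ACC-MAC}$ is the closure of the set of achievable pairs. The capacity region $\mathcal C_{ACMAC}$ is defined in the same way, but with $f_2:\mathcal M_1\times\mathcal M_2\to\mathcal X_2^n$ and words $f_1(m_1),f_2(m_1,m_2)$ (the informed encoder knows the message). Fix any filling rule $\sigma$, in $S$ or not, and let $$\check{\mathcal R}_n=\bigcup_{P(\mathbf x_1,\mathbf x_2)}\bigcap_{d\in\mathcal D}\Big\{(R_1,R_2)\in[0,\infty)^2:\ R_1\le\tfrac1nH(\mathbf X_1),\ R_2\le\tfrac1nI_d(\mathbf X_2;\mathbf Y|\mathbf X_1),\ R_1+R_2\le\tfrac1nI_d(\mathbf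 X_1,\mathbf X_2;\mathbf Y)\Big\},$$ where the union is over all probability mass functions on $\mathcal X_1^n\times\mathcal X_2^n$ and the functionals (in bits) are those of $P(\mathbf x_1,\mathbf x_2)P_d(\mathbf y|\mathbf x_1,\mathbf x_2)$, with $P_d$ formed with $\sigma$. Let $\check{\mathcal Q}_n$ be defined in the same way with $\mathbf Y$ replaced by $Y_{d_{max}+1}^{n-d_{min}}$, whose conditional law is $\prod_{i=d_{max}+1}^{n-d_{min}}P_{Y|X_1,X_2}(y_i|x_{1,i-d},x_{2,i})$. Then $$\mathcal C_{ACC-MAC}=\mathrm{closure}\Big(\bigcup_{n\ge D}\check{\mathcal Q}_n\Big)=\mathrm{closure}\Big(\limsup_{n\to\infty}\check{\mathcal R}_n\Big)=\mathrm{closure}\Big(\liminf_{n\to\infty}\check{\mathcal R}_n\Big),$$ where $\limsup_n A_n=\bigcap_m\bigcup_{n\ge m}A_n$ and $\liminf_n A_n=\bigcup_m\bigcap_{n\ge m}A_n$. Moreover, $\mathcal C_{ACC-MAC}\subseteq\mathcal C_{ACMAC}$. -/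

import Mathlib

open Filter Topology

namespace AsyncMAC

noncomputable section

/-! ### Information measures (in bits) of random variables on a finite probability space -/

section Info

variable {Ω A B C : Type*} [Fintype Ω] [Fintype A] [Fintype B] [Fintype C]

open scoped Classical in
/-- The law of the random variable `X` when `ω` has probability mass function `q`. -/
def law (q : Ω → ℝ) (X : Ω → A) (a : A) : ℝ :=
  ∑ ω, if X ω = a then q ω else 0

/-- Shannon entropy `H(X)`. -/
def entropy (q : Ω → ℝ) (X : Ω → A) : ℝ :=
  -∑ a, law q X a * Real.logb 2 (law q X a)

/-- Mutual information `I(X;Y)`. -/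
def mutualInfo (q : Ω → ℝ) (X : Ω → A) (Y : Ω → B) : ℝ :=
  ∑ a, ∑ b, law q (fun ω => (X ω, Y ω)) (a, b) *
    Real.logb 2 (law q (fun ω => (X ω, Y ω)) (a, b) / (law q X a * law q Y b))

/-- Conditional mutual information `I(X;Y|Z)`, that is, the sum of
`p(x,y,z) log (p(x,y|z) / (p(x|z) p(y|z)))`. -/
def condMutualInfo (q : Ω → ℝ) (X : Ω → A) (Y : Ω → B) (Z : Ω → C) : ℝ :=
  ∑ a, ∑ b, ∑ c, law q (fun ω => (X ω, Y ω, Z ω)) (a, b, c) *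
    Real.logb 2
      ((law q (fun ω => (X ω, Y ω, Z ω)) (a, b, c) / law q Z c) /
        ((law q (fun ω => (X ω, Z ω)) (a, c) / law q Z c) *
          (law q (fun ω => (Y ω, Z ω)) (b, c) / law q Z c)))

end Info

/-! ### The channel with delay -/

/-- The set of delays `{-dmin, …, dmax}`. -/
abbrev Delay (dmin dmax : ℕ) : Type := Set.Icc (-(dmin : ℤ)) (dmax : ℤ)

/-- A rule supplying the arbitrary symbols `x_{1,k}` at the times `k` outside the block. It may
depend on the block length, the delay and the two transmitted words; only its values at times
outside the block are ever used. -/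
abbrev FillRule (X₁ X₂ : Type*) (dmin dmax : ℕ) : Type _ :=
  (n : ℕ) → Delay dmin dmax → (Fin n → X₁) → (Fin n → X₂) → ℤ → X₁

variable {X₁ X₂ Y : Type*} {dmin dmax : ℕ}

/-- The symbol of `x` at time `k` (times are `0, …, n-1`), or `fill k` outside the block. -/
def symbolAt {n : ℕ} (x : Fin n → X₁) (fill : ℤ → X₁) (k : ℤ) : X₁ :=
  if h : 0 ≤ k ∧ k < n then x ⟨k.toNat, by omega⟩ else fill k

/-- `P_d(y | x₁, x₂) = ∏ᵢ W(yᵢ | x_{1,i-d}, x_{2,i})`, with out-of-block symbols given by `σ`. -/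
def transProb (W : X₁ → X₂ → Y → ℝ) (σ : FillRule X₁ X₂ dmin dmax) (n : ℕ)
    (d : Delay dmin dmax) (x₁ : Fin n → X₁) (x₂ : Fin n → X₂) (y : Fin n → Y) : ℝ :=
  ∏ i : Fin n, W (symbolAt x₁ (σ n d x₁ x₂) ((i : ℤ) - (d : ℤ))) (x₂ i) (y i)

/-- The times that remain after the first `dmax` and the last `dmin` times of a block of length
`n` are dropped. -/
abbrev Window (n dmin dmax : ℕ) : Type := {i : Fin n // dmax ≤ (i : ℕ) ∧ (i : ℕ) + dmin < n}

/-- The time `i - d`, which lies in the block when `i` lies in the window. -/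
def Window.delayed {n : ℕ} (i : Window n dmin dmax) (d : Delay dmin dmax) : Fin n :=
  ⟨((i.1 : ℤ) - (d : ℤ)).toNat, by
    have h1 := i.2.1
    have h2 := i.2.2
    have h3 := d.2.1
    have h4 := d.2.2
    omega⟩

/-- The conditional law of the outputs in the window given the two input words. -/
def windowTransProb (W : X₁ → X₂ → Y → ℝ) (n : ℕ) (d : Delay dmin dmax)
    (x₁ : Fin n → X₁) (x₂ : Fin n → X₂) (y : Window n dmin dmax → Y) : ℝ :=
  ∏ i : Window n dmin dmax, W (x₁ (i.delayed d)) (x₂ i.1) (y i)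

/-! ### Codes and capacity regions -/

/-- A code in which the informed encoder knows the message of the uninformed one. -/
structure ACMACCode (X₁ X₂ Y : Type*) (n M₁ M₂ : ℕ) where
  enc₁ : Fin M₁ → Fin n → X₁
  enc₂ : Fin M₁ → Fin M₂ → Fin n → X₂
  dec : (Fin n → Y) → Fin M₁ × Fin M₂

/-- A code in which the informed encoder knows only the codeword of the uninformed one. -/
structure ACCMACCode (X₁ X₂ Y : Type*) (n M₁ M₂ : ℕ) where
  enc₁ : Fin M₁ → Fin n → X₁
  enc₂ : (Fin n → X₁) → Fin M₂ → Fin n → X₂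
  dec : (Fin n → Y) → Fin M₁ × Fin M₂

/-- The message-cognition code induced by a codeword-cognition code. -/
def ACCMACCode.toACMAC {n M₁ M₂ : ℕ} (c : ACCMACCode X₁ X₂ Y n M₁ M₂) :
    ACMACCode X₁ X₂ Y n M₁ M₂ where
  enc₁ := c.enc₁
  enc₂ := fun m₁ m₂ => c.enc₂ (c.enc₁ m₁) m₂
  dec := c.dec

/-- The average probability of error under delay `d`. -/
def ACMACCode.errorProb [Fintype Y] {n M₁ M₂ : ℕ} (c : ACMACCode X₁ X₂ Y n M₁ M₂)
    (W : X₁ → X₂ → Y → ℝ) (σ : FillRule X₁ X₂ dmin dmax) (d : Delay dmin dmax) : ℝ :=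
  1 / ((M₁ : ℝ) * (M₂ : ℝ)) * ∑ m₁ : Fin M₁, ∑ m₂ : Fin M₂, ∑ y : Fin n → Y,
    if c.dec y ≠ (m₁, m₂) then transProb W σ n d (c.enc₁ m₁) (c.enc₂ m₁ m₂) y else 0

/-- The average probability of error under delay `d`: the words sent for `(m₁, m₂)` are
`enc₁ m₁` and `enc₂ (enc₁ m₁) m₂`. -/
def ACCMACCode.errorProb [Fintype Y] {n M₁ M₂ : ℕ} (c : ACCMACCode X₁ X₂ Y n M₁ M₂)
    (W : X₁ → X₂ → Y → ℝ) (σ : FillRule X₁ X₂ dmin dmax) (d : Delay dmin dmax) : ℝ :=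
  c.toACMAC.errorProb W σ d

/-- The number `⌈2^{nR}⌉` of messages at rate `R` and block length `n`. -/
def numMessages (n : ℕ) (R : ℝ) : ℕ := ⌈(2 : ℝ) ^ ((n : ℝ) * R)⌉₊

/-- Achievability of a pair of nonnegative rates for the ACMAC. `S` is the set of rules for the
out-of-block symbols against which the code has to work (a single rule: a fixed convention; all
rules: the worst case). The delay is unknown to encoders and decoder. -/
def ACMACAchievable [Fintype Y] (W : X₁ → X₂ → Y → ℝ) (S : Set (FillRule X₁ X₂ dmin dmax))
    (R : ℝ × ℝ) : Prop :=
  0 ≤ R.1 ∧ 0 ≤ R.2 ∧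
    ∃ (c : (n : ℕ) → ACMACCode X₁ X₂ Y n (numMessages n R.1) (numMessages n R.2)) (ε : ℕ → ℝ),
      Tendsto ε atTop (𝓝 0) ∧
        ∀ (n : ℕ) (d : Delay dmin dmax), ∀ σ ∈ S, (c n).errorProb W σ d ≤ ε n

/-- Achievability of a pair of nonnegative rates for the ACC-MAC. -/
def ACCMACAchievable [Fintype Y] (W : X₁ → X₂ → Y → ℝ) (S : Set (FillRule X₁ X₂ dmin dmax))
    (R : ℝ × ℝ) : Prop :=
  0 ≤ R.1 ∧ 0 ≤ R.2 ∧
    ∃ (c : (n : ℕ) → ACCMACCode X₁ X₂ Y n (numMessages n R.1) (numMessages n R.2)) (ε : ℕ → ℝ),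
      Tendsto ε atTop (𝓝 0) ∧
        ∀ (n : ℕ) (d : Delay dmin dmax), ∀ σ ∈ S, (c n).errorProb W σ d ≤ ε n

/-- The capacity region of the ACMAC. -/
def capacityACMAC [Fintype Y] (W : X₁ → X₂ → Y → ℝ) (S : Set (FillRule X₁ X₂ dmin dmax)) :
    Set (ℝ × ℝ) :=
  closure {R | ACMACAchievable W S R}

/-- The capacity region of the ACC-MAC. -/
def capacityACCMAC [Fintype Y] (W : X₁ → X₂ → Y → ℝ) (S : Set (FillRule X₁ X₂ dmin dmax)) :
    Set (ℝ × ℝ) :=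
  closure {R | ACCMACAchievable W S R}

/-! ### Multi-letter regions -/

/-- `P(x₁, x₂, y) = P(x₁, x₂) K(y | x₁, x₂)`. -/
def joint {A₁ A₂ B : Type*} (P : A₁ × A₂ → ℝ) (K : A₁ → A₂ → B → ℝ) (ω : A₁ × A₂ × B) : ℝ :=
  P (ω.1, ω.2.1) * K ω.1 ω.2.1 ω.2.2

/-- The nonnegative pairs `(R₁, R₂)` with `R₁ ≤ H(X₁)/n`, `R₂ ≤ I(X₂;Y|X₁)/n` and
`R₁ + R₂ ≤ I(X₁,X₂;Y)/n`, where `(X₁, X₂)` has law `P` and `K` is the law of `Y` given them. -/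
def rateRegion {A₁ A₂ B : Type*} [Fintype A₁] [Fintype A₂] [Fintype B] (n : ℕ)
    (P : A₁ × A₂ → ℝ) (K : A₁ → A₂ → B → ℝ) : Set (ℝ × ℝ) :=
  {R | 0 ≤ R.1 ∧ 0 ≤ R.2 ∧
    R.1 ≤ 1 / (n : ℝ) * entropy (joint P K) (fun ω => ω.1) ∧
    R.2 ≤ 1 / (n : ℝ) *
      condMutualInfo (joint P K) (fun ω => ω.2.1) (fun ω => ω.2.2) (fun ω => ω.1) ∧
    R.1 + R.2 ≤ 1 / (n : ℝ) *
      mutualInfo (joint P K) (fun ω => (ω.1, ω.2.1)) (fun ω => ω.2.2)}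

variable [Fintype X₁] [Fintype X₂] [Fintype Y]

/-- The region `Ř_n`, formed with the whole output block. -/
def regionR (W : X₁ → X₂ → Y → ℝ) (σ : FillRule X₁ X₂ dmin dmax) (n : ℕ) : Set (ℝ × ℝ) :=
  ⋃ P ∈ stdSimplex ℝ ((Fin n → X₁) × (Fin n → X₂)), ⋂ d : Delay dmin dmax,
    rateRegion n P (transProb W σ n d)

/-- The region `Q̌_n`, formed with the outputs in the window only. -/
def regionQ (W : X₁ → X₂ → Y → ℝ) (dmin dmax n : ℕ) : Set (ℝ × ℝ) :=
  ⋃ P ∈ stdSimplex ℝ ((Fin n → X₁) × (Fin n → X₂)), ⋂ d : Delay dmin dmax,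
    rateRegion n P (windowTransProb W n d)

end

end AsyncMAC

/-! The proof closes a cycle of inclusions: capacity region, closure of the liminf of `regionR`,
closure of its limsup, closure of the union of `regionQ`, capacity region.

Direct part. A long block is cut into sub-blocks of length `n`, and only the outputs in the window
of each sub-block are used. There the delayed symbol always comes from the same sub-block, so
neither the filling rule nor the neighbours matter, and the sub-blocks are independent uses of one
vector channel selected by the unknown delay (`sum_transProb_blocks`). This is a compound channel
with finitely many states, for which a random superposition code works with a decoder that tests
every delay (`codebook_mean_error_le`, `exists_block_codes`). The bound by `H(X₁)` is the price of
codeword cognition: satellites are attached to the cloud centre, so two messages with the same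
centre share all their words.

Converse. For uniform messages, Fano's inequality bounds the rates by the informations of the
induced input law (`ACCMACCode.converse`). The informed encoder sees only the codeword, so the
output depends on the first message through its codeword alone; this gives the bound by `H(X₁)`.

Comparison of regions. The window discards at most `dmax + dmin` outputs, which changes the
informations by a bounded number of bits, negligible after division by `n`. The window law does not
involve the filling rule, so all rules give the same limit; this is why `σ` need not lie in `S`.
Every loss is a reduction of both rates by a small `η` (`shrink`), absorbed by the closure. -/

namespace AsyncMAC

set_option linter.unusedSectionVars false

/-! ### Entropy inequalities and Fano's inequality -/

section Info

variable {Ω A B C : Type*} [Fintype Ω] [Fintype A] [Fintype B] [Fintype C]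

lemma sum_law_mul (q : Ω → ℝ) (X : Ω → A) (f : A → ℝ) :
    ∑ a, law q X a * f a = ∑ ω, q ω * f (X ω) := by
  classical
  simp only [law, Finset.sum_mul, ite_mul, zero_mul]
  rw [Finset.sum_comm]
  simp

lemma law_nonneg {q : Ω → ℝ} (hq : ∀ ω, 0 ≤ q ω) (X : Ω → A) (a : A) : 0 ≤ law q X a :=
  Finset.sum_nonneg fun ω _ => by split_ifs <;> simp [hq]

lemma sum_law (q : Ω → ℝ) (X : Ω → A) : ∑ a, law q X a = ∑ ω, q ω := by
  simpa using sum_law_mul q X (fun _ => 1)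

lemma law_mem_stdSimplex {q : Ω → ℝ} (hq : q ∈ stdSimplex ℝ Ω) (X : Ω → A) :
    law q X ∈ stdSimplex ℝ A :=
  ⟨law_nonneg hq.1 X, (sum_law q X).trans hq.2⟩

lemma le_law {q : Ω → ℝ} (hq : ∀ ω, 0 ≤ q ω) (X : Ω → A) (ω : Ω) : q ω ≤ law q X (X ω) := by
  classical
  refine le_trans ?_ (Finset.single_le_sum (f := fun ω' => if X ω' = X ω then q ω' else 0)
    (fun ω' _ => ?_) (Finset.mem_univ ω))
  · simp
  · split_ifs <;> simp [hq]

lemma law_pos {q : Ω → ℝ} (hq : ∀ ω, 0 ≤ q ω) (X : Ω → A) {ω : Ω} (h : 0 < q ω) :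
    0 < law q X (X ω) := h.trans_le (le_law hq X ω)

lemma law_law (q : Ω → ℝ) (X : Ω → A) (f : A → B) : law (law q X) f = law q (fun ω => f (X ω)) := by
  classical
  funext b
  have := sum_law_mul q X (fun a => if f a = b then 1 else 0)
  simpa [law] using this

lemma sum_law_fst (q : Ω → ℝ) (X : Ω → A) (Z : Ω → C) (c : C) :
    ∑ a, law q (fun ω => (X ω, Z ω)) (a, c) = law q Z c := by
  classical
  simp only [law]
  rw [Finset.sum_comm]
  refine Finset.sum_congr rfl fun ω _ => ?_
  by_cases h : Z ω = c <;> simp [h]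

lemma entropy_eq_sum (q : Ω → ℝ) (X : Ω → A) :
    entropy q X = -∑ ω, q ω * Real.logb 2 (law q X (X ω)) := by
  rw [entropy, sum_law_mul q X (fun a => Real.logb 2 (law q X a))]

lemma entropy_law (q : Ω → ℝ) (X : Ω → A) (f : A → B) :
    entropy (law q X) f = entropy q (fun ω => f (X ω)) := by
  rw [entropy, entropy, law_law]

lemma mutualInfo_law (q : Ω → ℝ) {D : Type*} [Fintype D] (X : Ω → D) (f : D → A) (g : D → B) :
    mutualInfo (law q X) f g = mutualInfo q (fun ω => f (X ω)) (fun ω => g (X ω)) := by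
  simp only [mutualInfo, law_law]

lemma condMutualInfo_law (q : Ω → ℝ) {D : Type*} [Fintype D] (X : Ω → D) (f : D → A) (g : D → B)
    (h : D → C) : condMutualInfo (law q X) f g h =
      condMutualInfo q (fun ω => f (X ω)) (fun ω => g (X ω)) (fun ω => h (X ω)) := by
  simp only [condMutualInfo, law_law]

/-- A coarser variable has larger point masses: the fibre of `X` through `ω` lies in that of `Y`, so
the logarithms compare pointwise. -/
lemma entropy_mono {q : Ω → ℝ} (hq : ∀ ω, 0 ≤ q ω) {X : Ω → A} {Y : Ω → B}
    (h : ∀ ω ω', X ω = X ω' → Y ω = Y ω') : entropy q Y ≤ entropy q X := by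
  classical
  rw [entropy_eq_sum, entropy_eq_sum]
  refine neg_le_neg (Finset.sum_le_sum fun ω _ => ?_)
  rcases (hq ω).eq_or_lt with h0 | h0
  · simp [← h0]
  refine mul_le_mul_of_nonneg_left ?_ h0.le
  refine Real.logb_le_logb_of_le (by norm_num) (law_pos hq X h0) ?_
  refine Finset.sum_le_sum fun ω' _ => ?_
  by_cases h1 : X ω' = X ω
  · simp [h1, h _ _ h1]
  · simp only [h1, if_false]
    split_ifs <;> simp [hq]

lemma entropy_congr {q : Ω → ℝ} (hq : ∀ ω, 0 ≤ q ω) {X : Ω → A} {Y : Ω → B}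
    (h : ∀ ω ω', X ω = X ω' ↔ Y ω = Y ω') : entropy q X = entropy q Y :=
  le_antisymm (entropy_mono hq fun _ _ => (h _ _).2) (entropy_mono hq fun _ _ => (h _ _).1)

/-- Gibbs' inequality in the form `E log s ≤ 0` when `E s ≤ 1`. -/
lemma sum_mul_logb_nonpos {q : Ω → ℝ} (hq : q ∈ stdSimplex ℝ Ω) {s : Ω → ℝ}
    (hs : ∀ ω, 0 < q ω → 0 < s ω) (h : ∑ ω, q ω * s ω ≤ 1) :
    ∑ ω, q ω * Real.logb 2 (s ω) ≤ 0 := by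
  have h1 : ∀ ω, q ω * Real.log (s ω) ≤ q ω * s ω - q ω := fun ω => by
    rcases (hq.1 ω).eq_or_lt with h0 | h0
    · simp [← h0]
    · have := mul_le_mul_of_nonneg_left (Real.log_le_sub_one_of_pos (hs ω h0)) h0.le
      linarith
  have h2 : ∑ ω, q ω * Real.log (s ω) ≤ 0 := by
    refine (Finset.sum_le_sum fun ω _ => h1 ω).trans ?_
    rw [Finset.sum_sub_distrib, hq.2]
    linarith
  simp only [Real.logb, ← mul_div_assoc, ← Finset.sum_div]
  exact div_nonpos_of_nonpos_of_nonneg h2 (Real.log_nonneg (by norm_num))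

/-- Gibbs' inequality for the ratio of the conditionally independent law `p₁ p₂ / p₃` to the true
law `p`. Nonnegativity of mutual information and data processing both come from here. -/
lemma entropy_submodular {q : Ω → ℝ} (hq : q ∈ stdSimplex ℝ Ω) (X : Ω → A) (Y : Ω → B)
    (Z : Ω → C) :
    entropy q (fun ω => (X ω, Y ω, Z ω)) + entropy q Z ≤
      entropy q (fun ω => (X ω, Z ω)) + entropy q (fun ω => (Y ω, Z ω)) := by
  set p := law q (fun ω => (X ω, Y ω, Z ω)) with hp
  set p₁ := law q (fun ω => (X ω, Z ω)) with hp₁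
  set p₂ := law q (fun ω => (Y ω, Z ω)) with hp₂
  set p₃ := law q Z with hp₃
  have key := sum_mul_logb_nonpos hq
    (s := fun ω => p₁ (X ω, Z ω) * p₂ (Y ω, Z ω) / (p (X ω, Y ω, Z ω) * p₃ (Z ω)))
    (fun ω h => div_pos (mul_pos (law_pos hq.1 (fun ω => (X ω, Z ω)) h)
      (law_pos hq.1 (fun ω => (Y ω, Z ω)) h))
      (mul_pos (law_pos hq.1 (fun ω => (X ω, Y ω, Z ω)) h) (law_pos hq.1 Z h))) (by
      rw [← sum_law_mul q (fun ω => (X ω, Y ω, Z ω))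
        (fun t => p₁ (t.1, t.2.2) * p₂ (t.2.1, t.2.2) / (p t * p₃ t.2.2))]
      calc _ ≤ ∑ t : A × B × C, p₁ (t.1, t.2.2) * p₂ (t.2.1, t.2.2) / p₃ t.2.2 := by
            refine Finset.sum_le_sum fun t _ => ?_
            rw [← hp]
            have h1 : 0 ≤ p₁ (t.1, t.2.2) := law_nonneg hq.1 _ _
            have h2 : 0 ≤ p₂ (t.2.1, t.2.2) := law_nonneg hq.1 _ _
            have h3 : 0 ≤ p₃ t.2.2 := law_nonneg hq.1 _ _
            have h4 : 0 ≤ p t := law_nonneg hq.1 _ _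
            rcases h4.eq_or_lt with h0 | h0
            · rw [← h0, zero_mul]
              positivity
            · refine le_of_eq ?_
              rw [mul_div_assoc', mul_div_mul_left _ _ h0.ne']
        _ = ∑ c, (∑ a, p₁ (a, c)) * (∑ b, p₂ (b, c)) / p₃ c := by
            simp only [Fintype.sum_prod_type]
            simp only [Finset.sum_mul_sum, Finset.sum_div]
            rw [Finset.sum_congr rfl fun a _ => Finset.sum_comm, Finset.sum_comm]
        _ = ∑ c, p₃ c := by
            refine Finset.sum_congr rfl fun c _ => ?_
            rw [hp₁, hp₂, sum_law_fst, sum_law_fst, ← hp₃]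
            exact mul_self_div_self _
        _ ≤ 1 := by rw [hp₃, sum_law, hq.2])
  have e : ∑ ω, q ω * Real.logb 2
      (p₁ (X ω, Z ω) * p₂ (Y ω, Z ω) / (p (X ω, Y ω, Z ω) * p₃ (Z ω))) =
      entropy q (fun ω => (X ω, Y ω, Z ω)) + entropy q Z -
        entropy q (fun ω => (X ω, Z ω)) - entropy q (fun ω => (Y ω, Z ω)) := by
    simp only [entropy_eq_sum, ← Finset.sum_neg_distrib]
    rw [← Finset.sum_add_distrib, ← Finset.sum_sub_distrib, ← Finset.sum_sub_distrib]
    refine Finset.sum_congr rfl fun ω _ => ?_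
    rcases (hq.1 ω).eq_or_lt with h0 | h
    · simp [← h0]
    have h1 := (law_pos hq.1 (fun ω => (X ω, Z ω)) h).ne'
    have h2 := (law_pos hq.1 (fun ω => (Y ω, Z ω)) h).ne'
    have h3 := (law_pos hq.1 (fun ω => (X ω, Y ω, Z ω)) h).ne'
    have h4 := (law_pos hq.1 Z h).ne'
    rw [Real.logb_div (mul_ne_zero h1 h2) (mul_ne_zero h3 h4), Real.logb_mul h1 h2,
      Real.logb_mul h3 h4]
    ring
  linarith

lemma entropy_const {q : Ω → ℝ} (hq : q ∈ stdSimplex ℝ Ω) (a : A) :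
    entropy q (fun _ => a) = 0 := by
  simp [entropy_eq_sum, law, hq.2]

lemma entropy_pair_le {q : Ω → ℝ} (hq : q ∈ stdSimplex ℝ Ω) (X : Ω → A) (Y : Ω → B) :
    entropy q (fun ω => (X ω, Y ω)) ≤ entropy q X + entropy q Y := by
  have h := entropy_submodular hq X Y (fun _ => ())
  rw [entropy_const hq] at h
  rw [entropy_congr hq.1 (X := X) (Y := fun ω => (X ω, ())) (by simp),
    entropy_congr hq.1 (X := Y) (Y := fun ω => (Y ω, ())) (by simp),
    entropy_congr hq.1 (X := fun ω => (X ω, Y ω)) (Y := fun ω => (X ω, Y ω, ())) (by simp)]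
  linarith

lemma entropy_le_logb_card {q : Ω → ℝ} (hq : q ∈ stdSimplex ℝ Ω) (X : Ω → A) :
    entropy q X ≤ Real.logb 2 (Fintype.card A) := by
  have hne : Nonempty Ω := by
    by_contra h
    rw [not_nonempty_iff] at h
    simpa using hq.2
  have hA : 0 < (Fintype.card A : ℝ) := by
    have : Nonempty A := ⟨X hne.some⟩
    exact_mod_cast Fintype.card_pos
  have key := sum_mul_logb_nonpos hq (s := fun ω => 1 / (law q X (X ω) * Fintype.card A))
    (fun ω h => by have := law_pos hq.1 X h; positivity) (by
      rw [← sum_law_mul q X (fun a => 1 / (law q X a * Fintype.card A))]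
      calc _ ≤ ∑ a : A, 1 / (Fintype.card A : ℝ) := by
            refine Finset.sum_le_sum fun a _ => ?_
            rcases (law_nonneg hq.1 X a).eq_or_lt with h0 | h0
            · rw [← h0, zero_mul]; positivity
            · refine le_of_eq ?_
              field_simp
        _ = 1 := by simp [hA.ne'])
  have e : ∑ ω, q ω * Real.logb 2 (1 / (law q X (X ω) * Fintype.card A)) =
      entropy q X - Real.logb 2 (Fintype.card A) := by
    have h1 : Real.logb 2 (Fintype.card A) = ∑ ω, q ω * Real.logb 2 (Fintype.card A) := by
      rw [← Finset.sum_mul, hq.2, one_mul]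
    rw [entropy_eq_sum, h1, ← Finset.sum_neg_distrib, ← Finset.sum_sub_distrib]
    refine Finset.sum_congr rfl fun ω _ => ?_
    rcases (hq.1 ω).eq_or_lt with h0 | h
    · simp [← h0]
    have h1 := (law_pos hq.1 X h).ne'
    rw [one_div, Real.logb_inv, Real.logb_mul h1 hA.ne']
    ring
  linarith

lemma mutualInfo_eq_sum (q : Ω → ℝ) (X : Ω → A) (Y : Ω → B) :
    mutualInfo q X Y = ∑ ω, q ω * Real.logb 2 (law q (fun ω => (X ω, Y ω)) (X ω, Y ω) /
      (law q X (X ω) * law q Y (Y ω))) := by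
  rw [mutualInfo, ← Fintype.sum_prod_type', ← sum_law_mul q (fun ω => (X ω, Y ω)) (fun t =>
    Real.logb 2 (law q (fun ω => (X ω, Y ω)) t / (law q X t.1 * law q Y t.2)))]

lemma condMutualInfo_eq_sum (q : Ω → ℝ) (X : Ω → A) (Y : Ω → B) (Z : Ω → C) :
    condMutualInfo q X Y Z = ∑ ω, q ω * Real.logb 2
      ((law q (fun ω => (X ω, Y ω, Z ω)) (X ω, Y ω, Z ω) / law q Z (Z ω)) /
        ((law q (fun ω => (X ω, Z ω)) (X ω, Z ω) / law q Z (Z ω)) *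
          (law q (fun ω => (Y ω, Z ω)) (Y ω, Z ω) / law q Z (Z ω)))) := by
  rw [← sum_law_mul q (fun ω => (X ω, Y ω, Z ω)) (fun t =>
    Real.logb 2 ((law q (fun ω => (X ω, Y ω, Z ω)) t / law q Z t.2.2) /
        ((law q (fun ω => (X ω, Z ω)) (t.1, t.2.2) / law q Z t.2.2) *
          (law q (fun ω => (Y ω, Z ω)) (t.2.1, t.2.2) / law q Z t.2.2))))]
  simp only [condMutualInfo, Fintype.sum_prod_type]

lemma mutualInfo_eq_entropy {q : Ω → ℝ} (hq : ∀ ω, 0 ≤ q ω) (X : Ω → A) (Y : Ω → B) :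
    mutualInfo q X Y = entropy q X + entropy q Y - entropy q (fun ω => (X ω, Y ω)) := by
  simp only [mutualInfo_eq_sum, entropy_eq_sum, ← Finset.sum_neg_distrib]
  rw [← Finset.sum_add_distrib, ← Finset.sum_sub_distrib]
  refine Finset.sum_congr rfl fun ω _ => ?_
  rcases (hq ω).eq_or_lt with h0 | h
  · simp [← h0]
  have h1 := (law_pos hq X h).ne'
  have h2 := (law_pos hq Y h).ne'
  have h3 := (law_pos hq (fun ω => (X ω, Y ω)) h).ne'
  rw [Real.logb_div h3 (mul_ne_zero h1 h2), Real.logb_mul h1 h2]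
  ring

lemma condMutualInfo_eq_entropy {q : Ω → ℝ} (hq : ∀ ω, 0 ≤ q ω) (X : Ω → A) (Y : Ω → B)
    (Z : Ω → C) :
    condMutualInfo q X Y Z = entropy q (fun ω => (X ω, Z ω)) + entropy q (fun ω => (Y ω, Z ω)) -
      entropy q (fun ω => (X ω, Y ω, Z ω)) - entropy q Z := by
  simp only [condMutualInfo_eq_sum, entropy_eq_sum, ← Finset.sum_neg_distrib]
  rw [← Finset.sum_add_distrib, ← Finset.sum_sub_distrib, ← Finset.sum_sub_distrib]
  refine Finset.sum_congr rfl fun ω _ => ?_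
  rcases (hq ω).eq_or_lt with h0 | h
  · simp [← h0]
  have h1 := (law_pos hq (fun ω => (X ω, Z ω)) h).ne'
  have h2 := (law_pos hq (fun ω => (Y ω, Z ω)) h).ne'
  have h3 := (law_pos hq (fun ω => (X ω, Y ω, Z ω)) h).ne'
  have h4 := (law_pos hq Z h).ne'
  rw [Real.logb_div (div_ne_zero h3 h4) (mul_ne_zero (div_ne_zero h1 h4) (div_ne_zero h2 h4)),
    Real.logb_mul (div_ne_zero h1 h4) (div_ne_zero h2 h4), Real.logb_div h3 h4,
    Real.logb_div h1 h4, Real.logb_div h2 h4]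
  ring

open scoped Classical in
/-- Fano's inequality. -/
lemma fano {q : Ω → ℝ} (hq : q ∈ stdSimplex ℝ Ω) (X : Ω → A) (Y : Ω → B) (g : B → A) :
    entropy q (fun ω => (X ω, Y ω)) - entropy q Y ≤
      1 + (∑ ω, if g (Y ω) ≠ X ω then q ω else 0) * Real.logb 2 (Fintype.card A) := by
  have hne : Nonempty Ω := by
    by_contra h
    rw [not_nonempty_iff] at h
    simpa using hq.2
  have hA : 0 < (Fintype.card A : ℝ) := by
    have : Nonempty A := ⟨X hne.some⟩
    exact_mod_cast Fintype.card_pos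
  -- A guess for the law of `X` given `Y`: half the mass on the estimate `g`, half spread uniformly.
  -- Its cost `-log r` is at most one bit when `g` is right and `1 + log |A|` when it is wrong.
  set r : A × B → ℝ := fun t =>
    (if g t.2 = t.1 then 1 / 2 else 0) + 1 / (2 * (Fintype.card A : ℝ)) with hr
  have hr0 : ∀ t, 0 < r t := fun t => by
    simp only [hr]
    split_ifs <;> positivity
  set p := law q (fun ω => (X ω, Y ω)) with hp
  have key := sum_mul_logb_nonpos hq
    (s := fun ω => r (X ω, Y ω) * law q Y (Y ω) / p (X ω, Y ω))
    (fun ω h => div_pos (mul_pos (hr0 _) (law_pos hq.1 Y h))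
      (law_pos hq.1 (fun ω => (X ω, Y ω)) h)) (by
      rw [← sum_law_mul q (fun ω => (X ω, Y ω)) (fun t => r t * law q Y t.2 / p t), ← hp]
      calc _ ≤ ∑ t : A × B, r t * law q Y t.2 := by
            refine Finset.sum_le_sum fun t _ => ?_
            have h4 : 0 ≤ p t := law_nonneg hq.1 _ _
            have h5 : 0 ≤ law q Y t.2 := law_nonneg hq.1 _ _
            rcases h4.eq_or_lt with h0 | h0
            · rw [← h0, zero_mul]
              exact mul_nonneg (hr0 t).le h5
            · rw [mul_div_cancel₀ _ h0.ne']
        _ = ∑ b, law q Y b := by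
            rw [Fintype.sum_prod_type_right]
            refine Finset.sum_congr rfl fun b _ => ?_
            dsimp only
            rw [← Finset.sum_mul]
            simp only [hr, Finset.sum_add_distrib, Finset.sum_ite_eq, Finset.mem_univ, if_true,
              Finset.sum_const, Finset.card_univ, nsmul_eq_mul]
            field_simp
            ring
        _ ≤ 1 := by rw [sum_law, hq.2])
  have e : ∑ ω, q ω * Real.logb 2 (r (X ω, Y ω) * law q Y (Y ω) / p (X ω, Y ω)) =
      entropy q (fun ω => (X ω, Y ω)) - entropy q Y + ∑ ω, q ω * Real.logb 2 (r (X ω, Y ω)) := by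
    simp only [entropy_eq_sum, ← Finset.sum_neg_distrib]
    rw [← Finset.sum_sub_distrib, ← Finset.sum_add_distrib]
    refine Finset.sum_congr rfl fun ω _ => ?_
    rcases (hq.1 ω).eq_or_lt with h0 | h
    · simp [← h0]
    have h1 := (hr0 (X ω, Y ω)).ne'
    have h2 := (law_pos hq.1 Y h).ne'
    have h3 := (law_pos hq.1 (fun ω => (X ω, Y ω)) h).ne'
    rw [Real.logb_div (mul_ne_zero h1 h2) h3, Real.logb_mul h1 h2]
    ring
  have e2 : -∑ ω, q ω * Real.logb 2 (r (X ω, Y ω)) ≤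
      1 + (∑ ω, if g (Y ω) ≠ X ω then q ω else 0) * Real.logb 2 (Fintype.card A) := by
    rw [Finset.sum_mul, ← hq.2, ← Finset.sum_add_distrib, ← Finset.sum_neg_distrib]
    refine Finset.sum_le_sum fun ω _ => ?_
    by_cases h : g (Y ω) = X ω
    · simp only [hr, h, ne_eq, not_true_eq_false, if_false, if_true, zero_mul, add_zero]
      have : Real.logb 2 (1 / 2) ≤ Real.logb 2 (1 / 2 + 1 / (2 * (Fintype.card A : ℝ))) :=
        Real.logb_le_logb_of_le (by norm_num) (by norm_num) (by
          have : 0 ≤ 1 / (2 * (Fintype.card A : ℝ)) := by positivity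
          linarith)
      rw [one_div, Real.logb_inv, Real.logb_self_eq_one (by norm_num), ← one_div] at this
      nlinarith [hq.1 ω]
    · simp only [hr, h, ne_eq, not_false_eq_true, if_false, if_true, zero_add]
      rw [one_div, Real.logb_inv, Real.logb_mul (by norm_num) hA.ne',
        Real.logb_self_eq_one (by norm_num)]
      linarith
  linarith

/-- If `k` is the conditional law of `Y` given `X`, then `H(Y|X)` is the mean of `-log k`. -/
lemma entropy_pair_sub {q : Ω → ℝ} (hq : ∀ ω, 0 ≤ q ω) (X : Ω → A) (Y : Ω → B) (k : A → B → ℝ)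
    (h : ∀ a b, law q (fun ω => (X ω, Y ω)) (a, b) = law q X a * k a b) :
    entropy q (fun ω => (X ω, Y ω)) - entropy q X =
      -∑ ω, q ω * Real.logb 2 (k (X ω) (Y ω)) := by
  simp only [entropy_eq_sum, ← Finset.sum_neg_distrib]
  rw [← Finset.sum_sub_distrib]
  refine Finset.sum_congr rfl fun ω _ => ?_
  rcases (hq ω).eq_or_lt with h0 | h'
  · simp [← h0]
  have h1 := (law_pos hq X h').ne'
  have h2 := (law_pos hq (fun ω => (X ω, Y ω)) h').ne'
  have h3 : k (X ω) (Y ω) ≠ 0 := fun h3 => h2 (by rw [h, h3, mul_zero])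
  rw [h, Real.logb_mul h1 h3]
  ring

/-- The kernel is constant on a fibre of `φ`, so it factors out of the sum over that fibre. -/
lemma law_pair_comp {q : Ω → ℝ} (X : Ω → A) (Y : Ω → B) (φ : A → C) (k : C → B → ℝ)
    (h : ∀ a b, law q (fun ω => (X ω, Y ω)) (a, b) = law q X a * k (φ a) b) (c : C) (b : B) :
    law q (fun ω => (φ (X ω), Y ω)) (c, b) = law q (fun ω => φ (X ω)) c * k c b := by
  classical
  rw [← law_law q (fun ω => (X ω, Y ω)) (fun t => (φ t.1, t.2)), ← law_law q X φ]
  conv_lhs => rw [law]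
  conv_rhs => rw [law]
  rw [Fintype.sum_prod_type, Finset.sum_mul]
  refine Finset.sum_congr rfl fun a _ => ?_
  by_cases ha : φ a = c
  · simp only [Prod.mk.injEq, ha, true_and, Finset.sum_ite_eq', Finset.mem_univ, if_true]
    rw [h, ha]
  · simp [ha]

/-- If the conditional law of `Y` given `X` depends on `X` through `φ X` only, then
`H(Y|X) = H(Y|φ X)`. -/
lemma entropy_pair_sub_comp {q : Ω → ℝ} (hq : ∀ ω, 0 ≤ q ω) (X : Ω → A) (Y : Ω → B) (φ : A → C)
    (k : C → B → ℝ)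
    (h : ∀ a b, law q (fun ω => (X ω, Y ω)) (a, b) = law q X a * k (φ a) b) :
    entropy q (fun ω => (X ω, Y ω)) - entropy q X =
      entropy q (fun ω => (φ (X ω), Y ω)) - entropy q (fun ω => φ (X ω)) := by
  rw [entropy_pair_sub hq X Y (fun a => k (φ a)) h,
    entropy_pair_sub hq (fun ω => φ (X ω)) Y k (law_pair_comp X Y φ k h)]

end Info

/-! ### Product laws, the weak law of large numbers and Markov's inequality -/

section Product

/-- Marginalization of a product of probability mass functions. -/
lemma sum_prod_comp {I J Y : Type*} [Fintype I] [Fintype J] [Fintype Y]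
    [DecidableEq I] [DecidableEq J] {e : J → I}
    (he : Function.Injective e) {w : I → Y → ℝ} (hw : ∀ i, ∑ c, w i c = 1)
    (F : (J → Y) → ℝ) :
    ∑ y : I → Y, (∏ i, w i (y i)) * F (fun j => y (e j)) =
      ∑ z : J → Y, (∏ j, w (e j) (z j)) * F z := by
  classical
  rw [← Finset.sum_fiberwise Finset.univ (fun (y : I → Y) j => y (e j))]
  refine Finset.sum_congr rfl fun z _ => ?_
  have h1 : ∑ y : I → Y with (fun j => y (e j)) = z, (∏ i, w i (y i)) * F (fun j => y (e j)) =
      (∑ y : I → Y with (fun j => y (e j)) = z, ∏ i, w i (y i)) * F z := by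
    rw [Finset.sum_mul]
    refine Finset.sum_congr rfl fun y hy => ?_
    rw [(Finset.mem_filter.1 hy).2]
  rw [h1]
  congr 1
  -- The fibre is a box: a single value at the coordinates in the range of `e`, everything
  -- elsewhere. The sum of the product is then a product of sums, and the free coordinates
  -- contribute 1.
  have h2 : (Finset.univ.filter fun y : I → Y => (fun j => y (e j)) = z) =
      Fintype.piFinset fun i => Finset.univ.filter fun c => ∀ j, e j = i → z j = c := by
    ext y
    simp only [Finset.mem_filter, Finset.mem_univ, true_and, Fintype.mem_piFinset]
    constructor
    · rintro rfl i j rfl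
      rfl
    · intro h
      funext j
      exact (h (e j) j rfl).symm
  rw [h2, ← Finset.prod_univ_sum]
  refine (Fintype.prod_of_injective e he _ _ (fun i hi => ?_) fun j => ?_).symm
  · rw [Finset.filter_true_of_mem, hw]
    exact fun c _ j hj => absurd ⟨j, hj⟩ hi
  · have : (Finset.univ.filter fun c => ∀ j', e j' = e j → z j' = c) = {z j} := by
      ext c
      simp only [Finset.mem_filter, Finset.mem_univ, true_and, Finset.mem_singleton]
      exact ⟨fun h => (h j rfl).symm, fun h j' hj => by rw [h, he hj]⟩
    rw [this, Finset.sum_singleton]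

variable {I Y Ω : Type*} [Fintype I] [DecidableEq I] [Fintype Y] [Fintype Ω]

lemma prod_mem_stdSimplex {w : I → Y → ℝ} (hw : ∀ i, w i ∈ stdSimplex ℝ Y) :
    (fun y : I → Y => ∏ i, w i (y i)) ∈ stdSimplex ℝ (I → Y) := by
  refine ⟨fun y => Finset.prod_nonneg fun i _ => (hw i).1 _, ?_⟩
  rw [← Fintype.piFinset_univ, ← Finset.prod_univ_sum]
  exact Finset.prod_eq_one fun i _ => (hw i).2

lemma sum_prod_apply {w : I → Y → ℝ} (hw : ∀ i, ∑ c, w i c = 1) (i : I) (F : Y → ℝ) :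
    ∑ y : I → Y, (∏ i, w i (y i)) * F (y i) = ∑ c, w i c * F c := by
  rw [sum_prod_comp (e := fun _ : Unit => i) (fun _ _ _ => rfl) hw (fun z => F (z ()))]
  exact Fintype.sum_equiv (Equiv.funUnique Unit Y) _ _ fun z => by simp

lemma sum_prod_apply₂ {w : I → Y → ℝ} (hw : ∀ i, ∑ c, w i c = 1) {i j : I} (hij : i ≠ j)
    (F : Y → Y → ℝ) :
    ∑ y : I → Y, (∏ i, w i (y i)) * F (y i) (y j) =
      ∑ a, w i a * ∑ b, w j b * F a b := by
  have he : Function.Injective ![i, j] := by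
    intro a b
    fin_cases a <;> fin_cases b <;> simp [hij, hij.symm]
  have := sum_prod_comp he hw (fun z => F (z 0) (z 1))
  simp only [Matrix.cons_val_zero, Matrix.cons_val_one] at this
  rw [this]
  simp only [Finset.mul_sum]
  rw [← Fintype.sum_prod_type']
  refine Fintype.sum_equiv (finTwoArrowEquiv Y) _ _ fun z => ?_
  simp [finTwoArrowEquiv, Fin.prod_univ_two, mul_assoc]

lemma sum_mul_le_of_mem_stdSimplex {q : Ω → ℝ} (hq : q ∈ stdSimplex ℝ Ω) {f : Ω → ℝ} {t : ℝ}
    (h : ∀ ω, f ω ≤ t) : ∑ ω, q ω * f ω ≤ t :=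
  (Finset.sum_le_sum fun ω _ => mul_le_mul_of_nonneg_left (h ω) (hq.1 ω)).trans_eq (by
    rw [← Finset.sum_mul, hq.2, one_mul])

/-- Expanding the square, the cross terms vanish by independence and centring. -/
lemma sum_prod_sq {q : Ω → ℝ} (hq : q ∈ stdSimplex ℝ Ω) {z : Ω → ℝ} (hz : ∑ ω, q ω * z ω = 0)
    (k : ℕ) : ∑ ω : Fin k → Ω, (∏ b, q (ω b)) * (∑ b, z (ω b)) ^ 2 =
      k * ∑ ω, q ω * z ω ^ 2 := by
  have h : ∀ b : Fin k, ∑ b', ∑ ω : Fin k → Ω, (∏ b, q (ω b)) * (z (ω b) * z (ω b')) =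
      ∑ ω, q ω * z ω ^ 2 := fun b => by
    rw [Finset.sum_eq_single b]
    · rw [sum_prod_apply (w := fun _ => q) (fun _ => hq.2) b (fun c => z c * z c)]
      simp only [sq]
    · intro b' _ hb
      rw [sum_prod_apply₂ (w := fun _ => q) (fun _ => hq.2) hb.symm (fun c c' => z c * z c')]
      refine Finset.sum_eq_zero fun a _ => ?_
      rw [Finset.sum_congr rfl fun b _ => show q b * (z a * z b) = z a * (q b * z b) by ring,
        ← Finset.mul_sum, hz, mul_zero, mul_zero]
    · simp
  calc _ = ∑ b : Fin k, ∑ b', ∑ ω : Fin k → Ω, (∏ b, q (ω b)) * (z (ω b) * z (ω b')) := by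
        rw [Finset.sum_congr rfl fun b _ => Finset.sum_comm, Finset.sum_comm]
        refine Finset.sum_congr rfl fun ω _ => ?_
        rw [sq, Finset.sum_mul_sum, Finset.mul_sum]
        simp only [Finset.mul_sum]
    _ = _ := by
        rw [Finset.sum_congr rfl fun b _ => h b]
        simp

open scoped Classical in
/-- A weak law of large numbers for the lower tail. -/
lemma exists_lower_tail_le {q : Ω → ℝ} (hq : q ∈ stdSimplex ℝ Ω) (Z : Ω → ℝ) {δ : ℝ}
    (hδ : 0 < δ) : ∃ C, ∀ k : ℕ, ∑ ω : Fin k → Ω, (∏ b, q (ω b)) *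
      (if ∑ b, Z (ω b) ≤ k * (∑ ω, q ω * Z ω - δ) then 1 else 0) ≤ C / (k + 1) := by
  set E := ∑ ω, q ω * Z ω with hE
  set v := ∑ ω, q ω * (Z ω - E) ^ 2 with hv
  have hv0 : 0 ≤ v := Finset.sum_nonneg fun ω _ => mul_nonneg (hq.1 ω) (sq_nonneg _)
  have hz : ∑ ω, q ω * (Z ω - E) = 0 := by
    simp only [mul_sub, Finset.sum_sub_distrib, ← Finset.sum_mul, hq.2]
    simp [hE]
  -- Chebyshev gives `(v / δ ^ 2) / k` for `k ≥ 1`; the factor 2 replaces `k` by `k + 1`, and the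
  -- summand 1 covers `k = 0`.
  refine ⟨1 + 2 * (v / δ ^ 2), fun k => ?_⟩
  have hprod := prod_mem_stdSimplex (I := Fin k) fun _ => hq
  rcases Nat.eq_zero_or_pos k with rfl | hk
  · refine (sum_mul_le_of_mem_stdSimplex hprod (t := 1) fun ω => ?_).trans ?_
    · split_ifs <;> norm_num
    · have : 0 ≤ v / δ ^ 2 := by positivity
      simp only [Nat.cast_zero, zero_add, div_one]
      linarith
  have hk' : (1 : ℝ) ≤ k := by exact_mod_cast hk
  have h1 : ∑ ω : Fin k → Ω, (∏ b, q (ω b)) *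
      (if ∑ b, Z (ω b) ≤ k * (E - δ) then 1 else 0) ≤
      ∑ ω : Fin k → Ω, (∏ b, q (ω b)) * (∑ b, (Z (ω b) - E)) ^ 2 / (k * δ) ^ 2 := by
    refine Finset.sum_le_sum fun ω _ => ?_
    rw [mul_div_assoc]
    refine mul_le_mul_of_nonneg_left ?_ (hprod.1 ω)
    split_ifs with h
    · rw [one_le_div (by positivity)]
      have : ∑ b, (Z (ω b) - E) ≤ -(k * δ) := by
        simp only [Finset.sum_sub_distrib, Finset.sum_const, Finset.card_univ, Fintype.card_fin,
          nsmul_eq_mul]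
        linarith
      have h0 : 0 < k * δ := by positivity
      nlinarith
    · positivity
  refine h1.trans ?_
  rw [← Finset.sum_div, sum_prod_sq hq hz, ← hv,
    show k * v / (k * δ) ^ 2 = (v / δ ^ 2) / k by field_simp, div_le_div_iff₀ (by linarith)
      (by linarith)]
  have : 0 ≤ v / δ ^ 2 := by positivity
  nlinarith

open scoped Classical in
/-- Markov's inequality for a likelihood ratio: `P(k > c E k) ≤ 1 / c`. -/
lemma sum_threshold_le {p : Ω → ℝ} (hp : ∀ ω, 0 ≤ p ω) {k : Ω → ℝ} (hk : ∀ ω, 0 ≤ k ω) {c : ℝ}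
    (hc : 0 < c) :
    ∑ ω, p ω * (if c * ∑ ω', p ω' * k ω' < k ω then 1 else 0) ≤ 1 / c := by
  set Q := ∑ ω', p ω' * k ω' with hQ
  have hpk : ∀ ω, 0 ≤ p ω * k ω := fun ω => mul_nonneg (hp ω) (hk ω)
  have hQ0 : 0 ≤ Q := Finset.sum_nonneg fun ω _ => hpk ω
  rcases hQ0.eq_or_lt with h0 | h0
  · have h1 : ∀ ω, p ω * k ω = 0 := fun ω =>
      (Finset.sum_eq_zero_iff_of_nonneg fun ω _ => hpk ω).1 (hQ ▸ h0.symm) ω (Finset.mem_univ ω)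
    rw [Finset.sum_eq_zero]
    · positivity
    · intro ω _
      rw [← h0, mul_zero]
      split_ifs with h
      · rw [mul_one]
        exact (mul_eq_zero.1 (h1 ω)).resolve_right h.ne'
      · simp
  · calc _ ≤ ∑ ω, p ω * k ω / (c * Q) := by
          refine Finset.sum_le_sum fun ω _ => ?_
          rw [mul_div_assoc]
          refine mul_le_mul_of_nonneg_left ?_ (hp ω)
          split_ifs with h
          · rw [one_le_div (by positivity)]
            exact h.le
          · have := hk ω
            positivity
      _ = 1 / c := by
          rw [← Finset.sum_div, ← hQ]
          field_simp

end Product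

/-! ### Random superposition coding for a finite family of channels -/

section Superposition

open scoped Classical in
/-- A threshold decoder outputs the message that passes the test, if only one does. -/
lemma exists_unique_decoder {B M : Type*} [Nonempty M] (T : B → M → Prop) :
    ∃ g : B → M, ∀ y m, T y m → (∀ m', m' ≠ m → ¬ T y m') → g y = m := by
  refine ⟨fun y => if h : ∃ m, T y m then h.choose else Classical.arbitrary M, fun y m h h' => ?_⟩
  have hex : ∃ m, T y m := ⟨m, h⟩
  simp only [dif_pos hex]
  by_contra hne
  exact h' _ hne hex.choose_spec

lemma exists_le_of_sum_mul_le {Ω : Type*} [Fintype Ω] {q : Ω → ℝ} (hq : q ∈ stdSimplex ℝ Ω)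
    {G : Ω → ℝ} {t : ℝ} (h : ∑ ω, q ω * G ω ≤ t) : ∃ ω, G ω ≤ t := by
  by_contra! hlt
  have h1 : ∑ ω, q ω * t < ∑ ω, q ω * G ω := by
    obtain ⟨ω, -, hω⟩ : ∃ ω ∈ Finset.univ, 0 < q ω := by
      refine Finset.exists_lt_of_sum_lt (f := fun _ => (0 : ℝ)) ?_
      simp [hq.2]
    refine Finset.sum_lt_sum (fun ω _ => mul_le_mul_of_nonneg_left (hlt ω).le (hq.1 ω))
      ⟨ω, Finset.mem_univ _, mul_lt_mul_of_pos_left (hlt ω) hω⟩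
  rw [← Finset.sum_mul, hq.2, one_mul] at h1
  linarith

variable {A X B D : Type*} [Fintype A] [Fintype X] [Fintype B] [Fintype D]
  [DecidableEq A] {M₁ M₂ : ℕ}

/-- The law of a random superposition codebook: cloud centres are independent with law `p`, and
satellites of the centre `a` are independent with law `V a`. -/
def codebookLaw (p : A → ℝ) (V : A → X → ℝ) (M₁ M₂ : ℕ)
    (c : (Fin M₁ → A) × (A × Fin M₂ → X)) : ℝ :=
  (∏ m, p (c.1 m)) * ∏ i, V i.1 (c.2 i)

variable {p : A → ℝ} {V : A → X → ℝ}

lemma sum_codebookLaw_mul (G : (Fin M₁ → A) × (A × Fin M₂ → X) → ℝ) :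
    ∑ c, codebookLaw p V M₁ M₂ c * G c =
      ∑ f₁ : Fin M₁ → A, (∏ m, p (f₁ m)) *
        ∑ f₂ : A × Fin M₂ → X, (∏ i, V i.1 (f₂ i)) * G (f₁, f₂) := by
  simp only [Fintype.sum_prod_type, codebookLaw, Finset.mul_sum, mul_assoc]

lemma codebookLaw_mem_stdSimplex (hp : p ∈ stdSimplex ℝ A) (hV : ∀ a, V a ∈ stdSimplex ℝ X) :
    codebookLaw p V M₁ M₂ ∈ stdSimplex ℝ _ := by
  have h1 := prod_mem_stdSimplex (I := Fin M₁) fun _ => hp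
  have h2 := prod_mem_stdSimplex (I := A × Fin M₂) fun i => hV i.1
  refine ⟨fun c => mul_nonneg (h1.1 _) (h2.1 _), ?_⟩
  have := sum_codebookLaw_mul (p := p) (V := V) (M₁ := M₁) (M₂ := M₂) fun _ => 1
  simp only [mul_one] at this
  rw [this, h2.2]
  simpa using h1.2

lemma codebook_mean_one (hp : p ∈ stdSimplex ℝ A) (hV : ∀ a, V a ∈ stdSimplex ℝ X)
    (m₁ : Fin M₁) (m₂ : Fin M₂) (F : A → X → ℝ) :
    ∑ c, codebookLaw p V M₁ M₂ c * F (c.1 m₁) (c.2 (c.1 m₁, m₂)) =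
      ∑ a, p a * ∑ x, V a x * F a x := by
  rw [sum_codebookLaw_mul, ← sum_prod_apply (fun _ : Fin M₁ => hp.2) m₁]
  refine Finset.sum_congr rfl fun f₁ _ => ?_
  rw [sum_prod_apply (w := fun i : A × Fin M₂ => V i.1) (fun i => (hV i.1).2) (f₁ m₁, m₂)
    (F (f₁ m₁))]

lemma codebook_mean_two_centres (hp : p ∈ stdSimplex ℝ A) (hV : ∀ a, V a ∈ stdSimplex ℝ X)
    {m₁ m₁' : Fin M₁} (h : m₁ ≠ m₁') (m₂ : Fin M₂) (F : A → A → X → ℝ) :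
    ∑ c, codebookLaw p V M₁ M₂ c * F (c.1 m₁) (c.1 m₁') (c.2 (c.1 m₁, m₂)) =
      ∑ a, p a * ∑ a', p a' * ∑ x, V a x * F a a' x := by
  rw [sum_codebookLaw_mul, ← sum_prod_apply₂ (fun _ : Fin M₁ => hp.2) h]
  refine Finset.sum_congr rfl fun f₁ _ => ?_
  rw [sum_prod_apply (w := fun i : A × Fin M₂ => V i.1) (fun i => (hV i.1).2) (f₁ m₁, m₂)
    (fun x => F (f₁ m₁) (f₁ m₁') x)]

lemma codebook_mean_two_satellites (hp : p ∈ stdSimplex ℝ A) (hV : ∀ a, V a ∈ stdSimplex ℝ X)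
    (m₁ : Fin M₁) {m₂ m₂' : Fin M₂} (h : m₂ ≠ m₂') (F : A → X → X → ℝ) :
    ∑ c, codebookLaw p V M₁ M₂ c * F (c.1 m₁) (c.2 (c.1 m₁, m₂)) (c.2 (c.1 m₁, m₂')) =
      ∑ a, p a * ∑ x, V a x * ∑ x', V a x' * F a x x' := by
  rw [sum_codebookLaw_mul, ← sum_prod_apply (fun _ : Fin M₁ => hp.2) m₁]
  refine Finset.sum_congr rfl fun f₁ _ => ?_
  rw [sum_prod_apply₂ (w := fun i : A × Fin M₂ => V i.1) (fun i => (hV i.1).2)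
    (i := (f₁ m₁, m₂)) (j := (f₁ m₁, m₂')) (by simpa using h) (F (f₁ m₁))]

/-- Equal centres share one family of satellites, so the two satellites are independent only when
the centres differ. `hF` removes the other case, which the error analysis charges to collisions of
centres. -/
lemma codebook_mean_two_clouds (hp : p ∈ stdSimplex ℝ A) (hV : ∀ a, V a ∈ stdSimplex ℝ X)
    {m₁ m₁' : Fin M₁} (h : m₁ ≠ m₁') (m₂ m₂' : Fin M₂) {F : A → A → X → X → ℝ}
    (hF : ∀ a x x', F a a x x' = 0) :
    ∑ c, codebookLaw p V M₁ M₂ c *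
        F (c.1 m₁) (c.1 m₁') (c.2 (c.1 m₁, m₂)) (c.2 (c.1 m₁', m₂')) =
      ∑ a, p a * ∑ a', p a' * ∑ x, V a x * ∑ x', V a' x' * F a a' x x' := by
  rw [sum_codebookLaw_mul, ← sum_prod_apply₂ (fun _ : Fin M₁ => hp.2) h]
  refine Finset.sum_congr rfl fun f₁ _ => ?_
  by_cases he : f₁ m₁ = f₁ m₁'
  · simp [he, hF]
  · rw [sum_prod_apply₂ (w := fun i : A × Fin M₂ => V i.1) (fun i => (hV i.1).2)
      (i := (f₁ m₁, m₂)) (j := (f₁ m₁', m₂')) (by simp [he]) (F (f₁ m₁) (f₁ m₁'))]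

lemma sum_mul_sum_comm {Ω : Type*} [Fintype Ω] (u : Ω → ℝ) (k : B → ℝ) (G : Ω → B → ℝ) :
    ∑ ω, u ω * ∑ y, k y * G ω y = ∑ y, k y * ∑ ω, u ω * G ω y := by
  simp only [Finset.mul_sum]
  rw [Finset.sum_comm]
  exact Finset.sum_congr rfl fun y _ => Finset.sum_congr rfl fun ω _ => by ring

lemma sum_sum_mul_comm {ι : Type*} (s : Finset ι) (k : B → ℝ) (f : ι → B → ℝ) :
    ∑ i ∈ s, ∑ y, k y * f i y = ∑ y, k y * ∑ i ∈ s, f i y := by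
  simp only [Finset.mul_sum]
  exact Finset.sum_comm

/-- The output law given the cloud centre. -/
def centreOutput (V : A → X → ℝ) (K : A → X → B → ℝ) (a : A) (y : B) : ℝ := ∑ x, V a x * K a x y

/-- The output law. -/
def outputLaw (p : A → ℝ) (V : A → X → ℝ) (K : A → X → B → ℝ) (y : B) : ℝ :=
  ∑ t : A × X, p t.1 * V t.1 t.2 * K t.1 t.2 y

open scoped Classical in
/-- The probability that the transmitted words fail the test of the threshold decoder. -/
noncomputable def failProb (p : A → ℝ) (V : A → X → ℝ) (K : A → X → B → ℝ) (c₁ c₂ c₁₂ : ℝ) : ℝ :=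
  ∑ a, p a * ∑ x, V a x * ∑ y, K a x y *
    if p a ≤ c₁ ∧ c₂ * centreOutput V K a y < K a x y ∧ c₁₂ * outputLaw p V K y < K a x y
      then 0 else 1

open scoped Classical in
-- If the true pair passes its test and decoding still fails, some other pair passes for some delay.
-- It has either the same first message (a wrong satellite beats `c₂`), another message with the
-- same centre (a collision), or a different centre (it beats `c₁₂`). A wrong satellite is
-- independent of the output given the centre, and a word pair with a different centre is
-- independent of it outright, so Markov's inequality bounds these events by `1 / c₂` and `1 / c₁₂`.
-- The condition `p a ≤ c₁` is not tested by the decoder; it is counted as a failure in `failProb`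
-- so that a collision costs at most `c₁`.
lemma codebook_mean_error_le (hp : p ∈ stdSimplex ℝ A) (hV : ∀ a, V a ∈ stdSimplex ℝ X)
    {K : D → A → X → B → ℝ} (hK : ∀ d a x, K d a x ∈ stdSimplex ℝ B)
    {c₁ : ℝ} {c₂ c₁₂ : D → ℝ} (hc₁ : 0 < c₁) (hc₂ : ∀ d, 0 < c₂ d) (hc₁₂ : ∀ d, 0 < c₁₂ d)
    (g : (Fin M₁ → A) × (A × Fin M₂ → X) → B → Fin M₁ × Fin M₂)
    (hg : ∀ c y (m : Fin M₁ × Fin M₂),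
      (∃ d, c₂ d * centreOutput V (K d) (c.1 m.1) y < K d (c.1 m.1) (c.2 (c.1 m.1, m.2)) y ∧
        c₁₂ d * outputLaw p V (K d) y < K d (c.1 m.1) (c.2 (c.1 m.1, m.2)) y) →
      (∀ m' : Fin M₁ × Fin M₂, m' ≠ m →
        ¬ ∃ d, c₂ d * centreOutput V (K d) (c.1 m'.1) y <
            K d (c.1 m'.1) (c.2 (c.1 m'.1, m'.2)) y ∧
          c₁₂ d * outputLaw p V (K d) y < K d (c.1 m'.1) (c.2 (c.1 m'.1, m'.2)) y) →
      g c y = m)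
    (d : D) (m₁ : Fin M₁) (m₂ : Fin M₂) :
    ∑ c, codebookLaw p V M₁ M₂ c * (∑ y, if g c y ≠ (m₁, m₂) then
        K d (c.1 m₁) (c.2 (c.1 m₁, m₂)) y else 0) ≤
      failProb p V (K d) c₁ (c₂ d) (c₁₂ d) + ((M₁ - 1) * c₁ + (M₂ - 1) * ∑ d, 1 / c₂ d +
        (M₁ - 1) * M₂ * ∑ d, 1 / c₁₂ d) := by
  set T₂ : D → A → X → B → Prop := fun d a x y => c₂ d * centreOutput V (K d) a y < K d a x y
    with hT₂
  set T₁₂ : D → A → X → B → Prop := fun d a x y => c₁₂ d * outputLaw p V (K d) y < K d a x y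
    with hT₁₂
  have hw := codebookLaw_mem_stdSimplex (M₁ := M₁) (M₂ := M₂) hp hV
  -- the four contributions to the error probability
  set F₁ : A → X → ℝ := fun a x => ∑ y, K d a x y *
    if p a ≤ c₁ ∧ T₂ d a x y ∧ T₁₂ d a x y then 0 else 1 with hF₁
  set F₂ : A → A → X → ℝ := fun a a' _ => if a' = a ∧ p a ≤ c₁ then 1 else 0 with hF₂
  set F₃ : D → A → X → X → ℝ := fun d' a x x' => ∑ y, K d a x y *
    if T₂ d' a x' y then 1 else 0 with hF₃
  set F₄ : D → A → A → X → X → ℝ := fun d' a a' x x' => ∑ y, K d a x y *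
    if a' ≠ a ∧ T₁₂ d' a' x' y then 1 else 0 with hF₄
  have hpt : ∀ c : (Fin M₁ → A) × (A × Fin M₂ → X),
      (∑ y, if g c y ≠ (m₁, m₂) then K d (c.1 m₁) (c.2 (c.1 m₁, m₂)) y else 0) ≤
      F₁ (c.1 m₁) (c.2 (c.1 m₁, m₂)) +
      ((∑ m₁' ∈ Finset.univ.erase m₁, F₂ (c.1 m₁) (c.1 m₁') (c.2 (c.1 m₁, m₂))) +
      ((∑ m₂' ∈ Finset.univ.erase m₂, ∑ d',
        F₃ d' (c.1 m₁) (c.2 (c.1 m₁, m₂)) (c.2 (c.1 m₁, m₂'))) +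
      ∑ m₁' ∈ Finset.univ.erase m₁, ∑ m₂', ∑ d',
        F₄ d' (c.1 m₁) (c.1 m₁') (c.2 (c.1 m₁, m₂)) (c.2 (c.1 m₁', m₂')))) := by
    intro c
    set a := c.1 m₁ with ha
    set x := c.2 (a, m₂) with hx
    -- The collision term does not depend on the output. Averaging it over `y` lets all four terms
    -- be compared for each `y` separately.
    have e₂ : ∀ a', F₂ a a' x = ∑ y, K d a x y * F₂ a a' x := fun a' => by
      rw [← Finset.sum_mul, (hK d a x).2, one_mul]
    rw [Finset.sum_congr rfl fun m₁' _ => e₂ (c.1 m₁'), sum_sum_mul_comm]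
    simp only [hF₁, hF₃, hF₄]
    rw [Finset.sum_congr rfl fun m₂' _ => sum_sum_mul_comm _ _ _, sum_sum_mul_comm,
      Finset.sum_congr rfl fun m₁' _ => Finset.sum_congr rfl fun m₂' _ =>
        sum_sum_mul_comm _ _ _, Finset.sum_congr rfl fun m₁' _ => sum_sum_mul_comm _ _ _,
      sum_sum_mul_comm, ← Finset.sum_add_distrib, ← Finset.sum_add_distrib,
      ← Finset.sum_add_distrib]
    refine Finset.sum_le_sum fun y _ => ?_
    rw [← mul_add, ← mul_add, ← mul_add, show (if g c y ≠ (m₁, m₂) then K d a x y else 0) =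
      K d a x y * (if g c y ≠ (m₁, m₂) then 1 else 0) by simp]
    refine mul_le_mul_of_nonneg_left ?_ ((hK d a x).1 y)
    set s₁ : ℝ := if p a ≤ c₁ ∧ T₂ d a x y ∧ T₁₂ d a x y then 0 else 1 with hs₁
    set s₂ : ℝ := ∑ m₁' ∈ Finset.univ.erase m₁, F₂ a (c.1 m₁') x with hs₂
    set s₃ : ℝ := ∑ m₂' ∈ Finset.univ.erase m₂, ∑ d',
      if T₂ d' a (c.2 (a, m₂')) y then 1 else 0 with hs₃
    set s₄ : ℝ := ∑ m₁' ∈ Finset.univ.erase m₁, ∑ m₂', ∑ d',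
      if c.1 m₁' ≠ a ∧ T₁₂ d' (c.1 m₁') (c.2 (c.1 m₁', m₂')) y then 1 else 0 with hs₄
    have n₁ : 0 ≤ s₁ := by rw [hs₁]; split_ifs <;> norm_num
    have n₂' : ∀ m₁', 0 ≤ F₂ a (c.1 m₁') x := fun m₁' => by simp only [hF₂]; split_ifs <;> norm_num
    have n₂ : 0 ≤ s₂ := Finset.sum_nonneg fun _ _ => n₂' _
    have n₃'' : ∀ (m₂' : Fin M₂) d', (0 : ℝ) ≤ if T₂ d' a (c.2 (a, m₂')) y then 1 else 0 :=
      fun m₂' d' => by split_ifs <;> norm_num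
    have n₃' : ∀ m₂' : Fin M₂, (0 : ℝ) ≤ ∑ d', if T₂ d' a (c.2 (a, m₂')) y then 1 else 0 :=
      fun m₂' => Finset.sum_nonneg fun _ _ => n₃'' _ _
    have n₃ : 0 ≤ s₃ := Finset.sum_nonneg fun _ _ => n₃' _
    have n₄''' : ∀ (m₁' : Fin M₁) (m₂' : Fin M₂) d', (0 : ℝ) ≤
        if c.1 m₁' ≠ a ∧ T₁₂ d' (c.1 m₁') (c.2 (c.1 m₁', m₂')) y then 1 else 0 :=
      fun m₁' m₂' d' => by split_ifs <;> norm_num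
    have n₄'' : ∀ (m₁' : Fin M₁) (m₂' : Fin M₂), (0 : ℝ) ≤ ∑ d',
        if c.1 m₁' ≠ a ∧ T₁₂ d' (c.1 m₁') (c.2 (c.1 m₁', m₂')) y then 1 else 0 :=
      fun m₁' m₂' => Finset.sum_nonneg fun _ _ => n₄''' _ _ _
    have n₄' : ∀ m₁' : Fin M₁, (0 : ℝ) ≤ ∑ m₂', ∑ d',
        if c.1 m₁' ≠ a ∧ T₁₂ d' (c.1 m₁') (c.2 (c.1 m₁', m₂')) y then 1 else 0 :=
      fun m₁' => Finset.sum_nonneg fun _ _ => n₄'' _ _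
    have n₄ : 0 ≤ s₄ := Finset.sum_nonneg fun _ _ => n₄' _
    split_ifs with hne
    · by_cases h1 : p a ≤ c₁ ∧ T₂ d a x y ∧ T₁₂ d a x y
      · obtain ⟨⟨m₁', m₂'⟩, hm, d', ht₂, ht₁₂⟩ : ∃ m' : Fin M₁ × Fin M₂, m' ≠ (m₁, m₂) ∧
            ∃ d', T₂ d' (c.1 m'.1) (c.2 (c.1 m'.1, m'.2)) y ∧
              T₁₂ d' (c.1 m'.1) (c.2 (c.1 m'.1, m'.2)) y := by
          by_contra! hcon
          exact hne (hg c y (m₁, m₂) ⟨d, h1.2⟩ fun m' hm' ⟨d', h⟩ => hcon m' hm' d' h.1 h.2)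
        by_cases hm₁ : m₁' = m₁
        · subst hm₁
          have hm₂ : m₂' ≠ m₂ := fun h => hm (by rw [h])
          have : 1 ≤ s₃ := by
            refine le_trans ?_ (Finset.single_le_sum (fun m _ => n₃' m)
              (Finset.mem_erase.2 ⟨hm₂, Finset.mem_univ _⟩))
            refine le_trans ?_ (Finset.single_le_sum (fun d' _ => n₃'' m₂' d')
              (Finset.mem_univ d'))
            rw [if_pos ht₂]
          linarith
        · by_cases hm₁' : c.1 m₁' = a
          · have : 1 ≤ s₂ := by
              refine le_trans ?_ (Finset.single_le_sum (fun m _ => n₂' m)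
                (Finset.mem_erase.2 ⟨hm₁, Finset.mem_univ _⟩))
              simp only [hF₂]
              rw [if_pos ⟨hm₁', h1.1⟩]
            linarith
          · have : 1 ≤ s₄ := by
              refine le_trans ?_ (Finset.single_le_sum (fun m _ => n₄' m)
                (Finset.mem_erase.2 ⟨hm₁, Finset.mem_univ _⟩))
              refine le_trans ?_ (Finset.single_le_sum (fun m _ => n₄'' m₁' m)
                (Finset.mem_univ m₂'))
              refine le_trans ?_ (Finset.single_le_sum (fun d' _ => n₄''' m₁' m₂' d')
                (Finset.mem_univ d'))
              rw [if_pos ⟨hm₁', ht₁₂⟩]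
            linarith
      · have : s₁ = 1 := if_neg h1
        linarith
    · linarith
  have b₁ : ∑ c, codebookLaw p V M₁ M₂ c * F₁ (c.1 m₁) (c.2 (c.1 m₁, m₂)) =
      failProb p V (K d) c₁ (c₂ d) (c₁₂ d) := codebook_mean_one hp hV m₁ m₂ F₁
  have b₂ : ∀ m₁' ∈ Finset.univ.erase m₁,
      ∑ c, codebookLaw p V M₁ M₂ c * F₂ (c.1 m₁) (c.1 m₁') (c.2 (c.1 m₁, m₂)) ≤ c₁ := by
    intro m₁' hm
    rw [codebook_mean_two_centres hp hV (Finset.ne_of_mem_erase hm).symm m₂ F₂]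
    refine sum_mul_le_of_mem_stdSimplex hp fun a => ?_
    simp only [hF₂, ← Finset.sum_mul, (hV a).2, one_mul]
    by_cases ha : p a ≤ c₁ <;> simp [ha, hc₁.le]
  have b₃ : ∀ m₂' ∈ Finset.univ.erase m₂, ∀ d', ∑ c, codebookLaw p V M₁ M₂ c *
      F₃ d' (c.1 m₁) (c.2 (c.1 m₁, m₂)) (c.2 (c.1 m₁, m₂')) ≤ 1 / c₂ d' := by
    intro m₂' hm d'
    rw [codebook_mean_two_satellites hp hV m₁ (Finset.ne_of_mem_erase hm).symm (F₃ d')]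
    refine sum_mul_le_of_mem_stdSimplex hp fun a => sum_mul_le_of_mem_stdSimplex (hV a) fun x => ?_
    rw [sum_mul_sum_comm]
    exact sum_mul_le_of_mem_stdSimplex (hK d a x) fun y =>
      sum_threshold_le (hV a).1 (fun x' => (hK d' a x').1 y) (hc₂ d')
  have b₄ : ∀ m₁' ∈ Finset.univ.erase m₁, ∀ m₂' d', ∑ c, codebookLaw p V M₁ M₂ c *
      F₄ d' (c.1 m₁) (c.1 m₁') (c.2 (c.1 m₁, m₂)) (c.2 (c.1 m₁', m₂')) ≤ 1 / c₁₂ d' := by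
    intro m₁' hm m₂' d'
    rw [codebook_mean_two_clouds hp hV (Finset.ne_of_mem_erase hm).symm m₂ m₂' (F := F₄ d')
      (by simp [hF₄])]
    refine sum_mul_le_of_mem_stdSimplex hp fun a => ?_
    -- Once the condition `a' ≠ a` is dropped, the competing words have the full input law, whose
    -- output mean is `outputLaw`, and Markov's inequality applies.
    calc _ ≤ ∑ a', p a' * ∑ x, V a x * ∑ x', V a' x' * ∑ y, K d a x y *
          (if T₁₂ d' a' x' y then 1 else 0) := by
          refine Finset.sum_le_sum fun a' _ => mul_le_mul_of_nonneg_left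
            (Finset.sum_le_sum fun x _ => mul_le_mul_of_nonneg_left
            (Finset.sum_le_sum fun x' _ => mul_le_mul_of_nonneg_left
            (Finset.sum_le_sum fun y _ => mul_le_mul_of_nonneg_left ?_ ((hK d a x).1 y))
            ((hV a').1 x')) ((hV a).1 x)) (hp.1 a')
          by_cases h1 : T₁₂ d' a' x' y
          · rw [if_pos h1]
            split_ifs <;> norm_num
          · rw [if_neg h1, if_neg fun h => h1 h.2]
      _ = ∑ x, V a x * ∑ y, K d a x y * ∑ t : A × X, p t.1 * V t.1 t.2 *
          (if T₁₂ d' t.1 t.2 y then 1 else 0) := by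
          rw [sum_mul_sum_comm]
          refine Finset.sum_congr rfl fun x _ => ?_
          rw [← sum_mul_sum_comm, Fintype.sum_prod_type]
          simp only [mul_assoc, ← Finset.mul_sum]
      _ ≤ 1 / c₁₂ d' := by
          refine sum_mul_le_of_mem_stdSimplex (hV a) fun x =>
            sum_mul_le_of_mem_stdSimplex (hK d a x) fun y => ?_
          exact sum_threshold_le (p := fun t : A × X => p t.1 * V t.1 t.2)
            (k := fun t => K d' t.1 t.2 y) (fun t => mul_nonneg (hp.1 _) ((hV _).1 _))
            (fun t => (hK d' t.1 t.2).1 y) (hc₁₂ d')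
  have hM₁ : ((Finset.univ.erase m₁).card : ℝ) = M₁ - 1 := by
    rw [Finset.card_erase_of_mem (Finset.mem_univ _), Finset.card_univ, Fintype.card_fin,
      Nat.cast_sub (by have := m₁.2; omega), Nat.cast_one]
  have hM₂ : ((Finset.univ.erase m₂).card : ℝ) = M₂ - 1 := by
    rw [Finset.card_erase_of_mem (Finset.mem_univ _), Finset.card_univ, Fintype.card_fin,
      Nat.cast_sub (by have := m₂.2; omega), Nat.cast_one]
  refine (Finset.sum_le_sum fun c _ => mul_le_mul_of_nonneg_left (hpt c) (hw.1 c)).trans ?_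
  simp only [mul_add, Finset.sum_add_distrib]
  rw [b₁, add_assoc]
  refine add_le_add_right (add_le_add ?_ (add_le_add ?_ ?_)) _
  · simp only [Finset.mul_sum]
    rw [Finset.sum_comm]
    refine (Finset.sum_le_sum b₂).trans_eq ?_
    rw [Finset.sum_const, nsmul_eq_mul, hM₁]
  · simp only [Finset.mul_sum]
    rw [Finset.sum_comm]
    refine (Finset.sum_le_sum (g := fun _ => ∑ d', 1 / c₂ d') fun m₂' hm => ?_).trans_eq ?_
    · rw [Finset.sum_comm]
      exact Finset.sum_le_sum fun d' _ => b₃ m₂' hm d'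
    · rw [Finset.sum_const, nsmul_eq_mul, hM₂, Finset.mul_sum]
  · simp only [Finset.mul_sum]
    rw [Finset.sum_comm]
    refine (Finset.sum_le_sum (g := fun _ => ∑ m₂' : Fin M₂, ∑ d', 1 / c₁₂ d')
      fun m₁' hm => ?_).trans_eq ?_
    · rw [Finset.sum_comm]
      refine Finset.sum_le_sum fun m₂' _ => ?_
      rw [Finset.sum_comm]
      exact Finset.sum_le_sum fun d' _ => b₄ m₁' hm m₂' d'
    · rw [Finset.sum_const, nsmul_eq_mul, hM₁, Finset.sum_const, nsmul_eq_mul, Finset.card_univ,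
        Fintype.card_fin, ← mul_assoc, Finset.mul_sum]

/-- Superposition coding over a finite set of channels, with a threshold decoder. -/
lemma exists_superposition_code (hp : p ∈ stdSimplex ℝ A) (hV : ∀ a, V a ∈ stdSimplex ℝ X)
    {K : D → A → X → B → ℝ} (hK : ∀ d a x, K d a x ∈ stdSimplex ℝ B)
    {c₁ : ℝ} {c₂ c₁₂ : D → ℝ} (hc₁ : 0 < c₁) (hc₂ : ∀ d, 0 < c₂ d) (hc₁₂ : ∀ d, 0 < c₁₂ d)
    (hM₁ : 0 < M₁) (hM₂ : 0 < M₂) :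
    ∃ (f₁ : Fin M₁ → A) (f₂ : A → Fin M₂ → X) (g : B → Fin M₁ × Fin M₂), ∀ d,
      1 / ((M₁ : ℝ) * M₂) * ∑ m₁, ∑ m₂, ∑ y,
        (if g y ≠ (m₁, m₂) then K d (f₁ m₁) (f₂ (f₁ m₁) m₂) y else 0) ≤
      ∑ d, (failProb p V (K d) c₁ (c₂ d) (c₁₂ d) + ((M₁ - 1) * c₁ + (M₂ - 1) * ∑ d, 1 / c₂ d +
        (M₁ - 1) * M₂ * ∑ d, 1 / c₁₂ d)) := by
  classical
  have : NeZero M₁ := ⟨hM₁.ne'⟩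
  have : NeZero M₂ := ⟨hM₂.ne'⟩
  choose g hg using fun c : (Fin M₁ → A) × (A × Fin M₂ → X) =>
    exists_unique_decoder (B := B) (M := Fin M₁ × Fin M₂) (fun y m =>
      ∃ d, c₂ d * centreOutput V (K d) (c.1 m.1) y < K d (c.1 m.1) (c.2 (c.1 m.1, m.2)) y ∧
        c₁₂ d * outputLaw p V (K d) y < K d (c.1 m.1) (c.2 (c.1 m.1, m.2)) y)
  have hw := codebookLaw_mem_stdSimplex (M₁ := M₁) (M₂ := M₂) hp hV
  have hM : (0 : ℝ) < (M₁ : ℝ) * M₂ := by positivity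
  set err : D → (Fin M₁ → A) × (A × Fin M₂ → X) → ℝ := fun d c =>
    1 / ((M₁ : ℝ) * M₂) * ∑ m₁, ∑ m₂, ∑ y,
      (if g c y ≠ (m₁, m₂) then K d (c.1 m₁) (c.2 (c.1 m₁, m₂)) y else 0) with herr
  have herr0 : ∀ d c, 0 ≤ err d c := fun d c => by
    refine mul_nonneg (by positivity) (Finset.sum_nonneg fun m₁ _ => Finset.sum_nonneg fun m₂ _ =>
      Finset.sum_nonneg fun y _ => ?_)
    split_ifs
    · exact (hK _ _ _).1 _
    · exact le_rfl
  have key : ∑ c, codebookLaw p V M₁ M₂ c * ∑ d, err d c ≤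
      ∑ d, (failProb p V (K d) c₁ (c₂ d) (c₁₂ d) + ((M₁ - 1) * c₁ + (M₂ - 1) * ∑ d, 1 / c₂ d +
        (M₁ - 1) * M₂ * ∑ d, 1 / c₁₂ d)) := by
    simp only [Finset.mul_sum]
    rw [Finset.sum_comm]
    simp only [← Finset.mul_sum]
    refine Finset.sum_le_sum fun d _ => ?_
    have h1 : ∑ c, codebookLaw p V M₁ M₂ c * err d c = 1 / ((M₁ : ℝ) * M₂) *
        ∑ m₁, ∑ m₂, ∑ c, codebookLaw p V M₁ M₂ c * (∑ y, if g c y ≠ (m₁, m₂) then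
          K d (c.1 m₁) (c.2 (c.1 m₁, m₂)) y else 0) := by
      simp only [herr]
      rw [Finset.sum_congr rfl fun m₁ _ => Finset.sum_comm, Finset.sum_comm, Finset.mul_sum]
      refine Finset.sum_congr rfl fun c _ => ?_
      simp only [← Finset.mul_sum]
      ring
    rw [h1]
    refine (mul_le_mul_of_nonneg_left (Finset.sum_le_sum fun m₁ _ => Finset.sum_le_sum fun m₂ _ =>
      codebook_mean_error_le hp hV hK hc₁ hc₂ hc₁₂ g hg d m₁ m₂) (by positivity)).trans_eq ?_
    simp only [Finset.sum_const, Finset.card_univ, Fintype.card_fin, nsmul_eq_mul]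
    field_simp
  -- The mean was taken of the sum of the errors over all channels; as these are nonnegative, one
  -- realization serves every channel.
  obtain ⟨c, hc⟩ := exists_le_of_sum_mul_le hw key
  exact ⟨c.1, fun a m₂ => c.2 (a, m₂), g c, fun d =>
    (Finset.single_le_sum (f := fun d => err d c) (fun d _ => herr0 d c)
      (Finset.mem_univ d)).trans hc⟩

end Superposition

/-! ### Marginals of the joint law of inputs and output -/

section Joint

variable {A X B : Type*} [Fintype A] [Fintype X] [Fintype B]
  {P : A × X → ℝ} {K : A → X → B → ℝ}

lemma sum_joint_mul (f : A × X × B → ℝ) :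
    ∑ ω, joint P K ω * f ω = ∑ a, ∑ x, P (a, x) * ∑ y, K a x y * f (a, x, y) := by
  simp only [joint, Fintype.sum_prod_type, Finset.mul_sum, mul_assoc]

lemma joint_mem_stdSimplex (hP : P ∈ stdSimplex ℝ (A × X)) (hK : ∀ a x, K a x ∈ stdSimplex ℝ B) :
    joint P K ∈ stdSimplex ℝ (A × X × B) := by
  refine ⟨fun ω => mul_nonneg (hP.1 _) ((hK _ _).1 _), ?_⟩
  have := sum_joint_mul (P := P) (K := K) fun _ => 1
  simp only [mul_one] at this
  rw [this, ← hP.2, Fintype.sum_prod_type]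
  simp [(hK _ _).2]

lemma law_joint_inputs (hK : ∀ a x, K a x ∈ stdSimplex ℝ B) :
    law (joint P K) (fun ω => (ω.1, ω.2.1)) = P := by
  classical
  funext ⟨a, x⟩
  simp only [law, joint, Fintype.sum_prod_type]
  rw [Finset.sum_eq_single a, Finset.sum_eq_single x]
  · simp [← Finset.mul_sum, (hK _ _).2]
  · intro x' _ h
    simp [h]
  · simp
  · intro a' _ h
    simp [h]
  · simp

lemma law_joint_fst (hK : ∀ a x, K a x ∈ stdSimplex ℝ B) (a : A) :
    law (joint P K) (fun ω => ω.1) a = ∑ x, P (a, x) := by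
  classical
  have : law (joint P K) (fun ω => ω.1) = law P Prod.fst := by
    conv_rhs => rw [← law_joint_inputs (P := P) hK, law_law]
  rw [this, law, Fintype.sum_prod_type, Finset.sum_eq_single a]
  · simp
  · intro a' _ h
    simp [h]
  · simp

lemma law_joint_snd (a : A) (x : X) (hK : ∀ a x, K a x ∈ stdSimplex ℝ B) :
    law (joint P K) (fun ω => (ω.2.1, ω.1)) (x, a) = P (a, x) := by
  classical
  have : law (joint P K) (fun ω => (ω.2.1, ω.1)) = law P Prod.swap := by
    conv_rhs => rw [← law_joint_inputs (P := P) hK, law_law]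
    rfl
  rw [this, law, Finset.sum_eq_single (a, x)]
  · simp
  · rintro ⟨a', x'⟩ _ h
    rw [if_neg]
    rintro h'
    apply h
    simpa [and_comm] using h'
  · simp

lemma law_joint_output (y : B) :
    law (joint P K) (fun ω => ω.2.2) y = ∑ t, P t * K t.1 t.2 y := by
  classical
  simp only [law, joint, Fintype.sum_prod_type]
  refine Finset.sum_congr rfl fun a _ => Finset.sum_congr rfl fun x _ => ?_
  simp

lemma law_joint_output_fst (y : B) (a : A) :
    law (joint P K) (fun ω => (ω.2.2, ω.1)) (y, a) = ∑ x, P (a, x) * K a x y := by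
  classical
  simp only [law, joint, Fintype.sum_prod_type]
  rw [Finset.sum_eq_single a]
  · refine Finset.sum_congr rfl fun x _ => ?_
    simp
  · intro a' _ h
    simp [h]
  · simp

lemma law_joint_perm (a : A) (x : X) (y : B) :
    law (joint P K) (fun ω => (ω.2.1, ω.2.2, ω.1)) (x, y, a) = joint P K (a, x, y) := by
  rw [law, Finset.sum_eq_single (a, x, y)]
  · simp
  · rintro ⟨a', x', y'⟩ _ h
    rw [if_neg]
    intro h'
    apply h
    simp only [Prod.mk.injEq] at h' ⊢
    tauto
  · simp

lemma law_joint_pair (a : A) (x : X) (y : B) :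
    law (joint P K) (fun ω => ((ω.1, ω.2.1), ω.2.2)) ((a, x), y) = joint P K (a, x, y) := by
  rw [law, Finset.sum_eq_single (a, x, y)]
  · simp
  · rintro ⟨a', x', y'⟩ _ h
    rw [if_neg]
    intro h'
    apply h
    simp only [Prod.mk.injEq] at h' ⊢
    tauto
  · simp

end Joint

/-! ### Information densities and typicality for independent repetitions -/

section Block

variable {A X B : Type*} [Fintype A] [Fintype X] [Fintype B]
  {p : A → ℝ} {V : A → X → ℝ} {K : A → X → B → ℝ}

/-- Disintegration of a probability mass function on a product. -/
lemma exists_disintegration [Nonempty X] {P : A × X → ℝ} (hP : P ∈ stdSimplex ℝ (A × X)) :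
    ∃ (p : A → ℝ) (V : A → X → ℝ), p ∈ stdSimplex ℝ A ∧ (∀ a, V a ∈ stdSimplex ℝ X) ∧
      P = fun t => p t.1 * V t.1 t.2 := by
  classical
  set p : A → ℝ := fun a => ∑ x, P (a, x) with hp
  have hp0 : ∀ a, 0 ≤ p a := fun a => Finset.sum_nonneg fun x _ => hP.1 _
  -- Where the marginal vanishes the conditional law is irrelevant; a point mass keeps it a
  -- probability law.
  refine ⟨p, fun a => if p a = 0 then Pi.single (Classical.arbitrary X) 1
    else fun x => P (a, x) / p a, ⟨hp0, ?_⟩, fun a => ?_, ?_⟩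
  · rw [← hP.2, Fintype.sum_prod_type]
  · dsimp only
    split_ifs with h
    · exact single_mem_stdSimplex ℝ _
    · refine ⟨fun x => div_nonneg (hP.1 _) (hp0 a), ?_⟩
      rw [← Finset.sum_div]
      exact div_self h
  · funext ⟨a, x⟩
    dsimp only
    split_ifs with h
    · rw [h, zero_mul]
      exact (Finset.sum_eq_zero_iff_of_nonneg fun x _ => hP.1 (a, x)).1 h x (Finset.mem_univ x)
    · rw [mul_div_cancel₀ _ h]

lemma prod_mul_mem_stdSimplex (hp : p ∈ stdSimplex ℝ A) (hV : ∀ a, V a ∈ stdSimplex ℝ X) :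
    (fun t : A × X => p t.1 * V t.1 t.2) ∈ stdSimplex ℝ (A × X) := by
  refine ⟨fun t => mul_nonneg (hp.1 _) ((hV _).1 _), ?_⟩
  rw [Fintype.sum_prod_type]
  simp only [← Finset.mul_sum, (hV _).2, mul_one, hp.2]

lemma entropy_joint_fst (hV : ∀ a, V a ∈ stdSimplex ℝ X) (hK : ∀ a x, K a x ∈ stdSimplex ℝ B) :
    entropy (joint (fun t => p t.1 * V t.1 t.2) K) (fun ω => ω.1) =
      ∑ ω, joint (fun t => p t.1 * V t.1 t.2) K ω * -Real.logb 2 (p ω.1) := by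
  rw [entropy_eq_sum, ← Finset.sum_neg_distrib]
  refine Finset.sum_congr rfl fun ω _ => ?_
  rw [law_joint_fst hK]
  simp only [← Finset.mul_sum, (hV _).2, mul_one, mul_neg]

/-- The factors `p a` and `V a x` cancel where they are positive, leaving the mean of the log-ratio
that the decoder compares with `c₂`. -/
lemma condMutualInfo_joint (hp : p ∈ stdSimplex ℝ A) (hV : ∀ a, V a ∈ stdSimplex ℝ X)
    (hK : ∀ a x, K a x ∈ stdSimplex ℝ B) :
    condMutualInfo (joint (fun t => p t.1 * V t.1 t.2) K) (fun ω => ω.2.1) (fun ω => ω.2.2)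
        (fun ω => ω.1) =
      ∑ ω, joint (fun t => p t.1 * V t.1 t.2) K ω *
        Real.logb 2 (K ω.1 ω.2.1 ω.2.2 / centreOutput V K ω.1 ω.2.2) := by
  rw [condMutualInfo_eq_sum]
  refine Finset.sum_congr rfl fun ⟨a, x, y⟩ _ => ?_
  dsimp only
  rw [law_joint_perm, law_joint_fst hK, law_joint_snd _ _ hK, law_joint_output_fst]
  simp only [joint, mul_assoc, ← Finset.mul_sum, (hV _).2, mul_one]
  rw [← centreOutput]
  rcases (hp.1 a).eq_or_lt with h | h
  · simp [← h]
  rcases ((hV a).1 x).eq_or_lt with h' | h'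
  · simp [← h']
  rw [mul_div_cancel_left₀ _ h.ne', mul_div_cancel_left₀ _ h.ne', mul_div_cancel_left₀ _ h.ne',
    mul_div_mul_left _ _ h'.ne']

lemma mutualInfo_joint (hp : p ∈ stdSimplex ℝ A) (hV : ∀ a, V a ∈ stdSimplex ℝ X)
    (hK : ∀ a x, K a x ∈ stdSimplex ℝ B) :
    mutualInfo (joint (fun t => p t.1 * V t.1 t.2) K) (fun ω => (ω.1, ω.2.1)) (fun ω => ω.2.2) =
      ∑ ω, joint (fun t => p t.1 * V t.1 t.2) K ω *
        Real.logb 2 (K ω.1 ω.2.1 ω.2.2 / outputLaw p V K ω.2.2) := by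
  rw [mutualInfo_eq_sum]
  refine Finset.sum_congr rfl fun ⟨a, x, y⟩ _ => ?_
  dsimp only
  rw [law_joint_pair, law_joint_inputs hK, law_joint_output]
  simp only [joint]
  rw [← outputLaw]
  rcases (mul_nonneg (hp.1 a) ((hV a).1 x)).eq_or_lt with h | h
  · simp [← h]
  rw [mul_div_mul_left _ _ h.ne']

lemma centreOutput_prod (k : ℕ) (a : Fin k → A) (y : Fin k → B) :
    centreOutput (fun (a : Fin k → A) (x : Fin k → X) => ∏ b, V (a b) (x b))
      (fun (a : Fin k → A) (x : Fin k → X) (y : Fin k → B) => ∏ b, K (a b) (x b) (y b)) a y =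
      ∏ b, centreOutput V K (a b) (y b) := by
  classical
  simp only [centreOutput, ← Finset.prod_mul_distrib]
  rw [Finset.prod_univ_sum, Fintype.piFinset_univ]

lemma outputLaw_prod (k : ℕ) (y : Fin k → B) :
    outputLaw (fun a : Fin k → A => ∏ b, p (a b))
      (fun (a : Fin k → A) (x : Fin k → X) => ∏ b, V (a b) (x b))
      (fun (a : Fin k → A) (x : Fin k → X) (y : Fin k → B) => ∏ b, K (a b) (x b) (y b)) y =
      ∏ b, outputLaw p V K (y b) := by
  classical
  simp only [outputLaw, ← Finset.prod_mul_distrib]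
  rw [Finset.prod_univ_sum, Fintype.piFinset_univ]
  exact Fintype.sum_equiv (Equiv.arrowProdEquivProdArrow (Fin k) (fun _ => A) (fun _ => X)).symm
    _ _ fun t => rfl

lemma rpow_lt_prod {k : ℕ} {r : Fin k → ℝ} (hr : ∀ b, 0 < r b) {t : ℝ}
    (h : t < ∑ b, Real.logb 2 (r b)) : (2 : ℝ) ^ t < ∏ b, r b := by
  have h1 : (2 : ℝ) ^ (∑ b, Real.logb 2 (r b)) = ∏ b, r b := by
    rw [Real.rpow_sum_of_pos (by norm_num)]
    exact Finset.prod_congr rfl fun b _ => Real.rpow_logb (by norm_num) (by norm_num) (hr b)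
  rw [← h1]
  exact Real.rpow_lt_rpow_of_exponent_lt (by norm_num) h

lemma sum_prod_eq_sum_joint (k : ℕ)
    (F : (Fin k → A) → (Fin k → X) → (Fin k → B) → ℝ) :
    ∑ a : Fin k → A, (∏ b, p (a b)) * ∑ x : Fin k → X, (∏ b, V (a b) (x b)) *
      ∑ y : Fin k → B, (∏ b, K (a b) (x b) (y b)) * F a x y =
    ∑ ω : Fin k → A × X × B, (∏ b, joint (fun t => p t.1 * V t.1 t.2) K (ω b)) *
      F (fun b => (ω b).1) (fun b => (ω b).2.1) (fun b => (ω b).2.2) := by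
  simp only [Finset.mul_sum]
  rw [← Fintype.sum_equiv ((Equiv.arrowProdEquivProdArrow (Fin k) (fun _ => A)
      (fun _ => X × B)).trans ((Equiv.refl _).prodCongr
      (Equiv.arrowProdEquivProdArrow (Fin k) (fun _ => X) (fun _ => B)))).symm
    (fun t => (∏ b, joint (fun t => p t.1 * V t.1 t.2) K (t.1 b, t.2.1 b, t.2.2 b)) *
      F t.1 t.2.1 t.2.2) _ fun t => rfl]
  simp only [Fintype.sum_prod_type]
  refine Finset.sum_congr rfl fun a _ => Finset.sum_congr rfl fun x _ =>
    Finset.sum_congr rfl fun y _ => ?_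
  simp only [joint, Finset.prod_mul_distrib]
  ring

open scoped Classical in
-- For product laws each condition in `failProb` concerns a sum of independent copies of an
-- information density, whose mean is the entropy or mutual information in the threshold. Failure
-- means that one of the three sums falls `k * δ` below its mean, and the weak law applies to each.
lemma exists_failProb_prod_le (hp : p ∈ stdSimplex ℝ A) (hV : ∀ a, V a ∈ stdSimplex ℝ X)
    (hK : ∀ a x, K a x ∈ stdSimplex ℝ B) {δ : ℝ} (hδ : 0 < δ) :
    ∃ C : ℝ, ∀ k : ℕ,
      failProb (fun a : Fin k → A => ∏ b, p (a b))
        (fun (a : Fin k → A) (x : Fin k → X) => ∏ b, V (a b) (x b))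
        (fun (a : Fin k → A) (x : Fin k → X) (y : Fin k → B) => ∏ b, K (a b) (x b) (y b))
        (2 ^ (-((k : ℝ) * (entropy (joint (fun t => p t.1 * V t.1 t.2) K) (fun ω => ω.1) - δ))))
        (2 ^ ((k : ℝ) * (condMutualInfo (joint (fun t => p t.1 * V t.1 t.2) K)
          (fun ω => ω.2.1) (fun ω => ω.2.2) (fun ω => ω.1) - δ)))
        (2 ^ ((k : ℝ) * (mutualInfo (joint (fun t => p t.1 * V t.1 t.2) K)
          (fun ω => (ω.1, ω.2.1)) (fun ω => ω.2.2) - δ))) ≤ C / (k + 1) := by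
  set q := joint (fun t : A × X => p t.1 * V t.1 t.2) K with hq
  have hqs : q ∈ stdSimplex ℝ (A × X × B) :=
    joint_mem_stdSimplex (prod_mul_mem_stdSimplex hp hV) hK
  obtain ⟨C₁, h₁⟩ := exists_lower_tail_le hqs (fun ω => -Real.logb 2 (p ω.1)) hδ
  obtain ⟨C₂, h₂⟩ := exists_lower_tail_le hqs
    (fun ω => Real.logb 2 (K ω.1 ω.2.1 ω.2.2 / centreOutput V K ω.1 ω.2.2)) hδ
  obtain ⟨C₃, h₃⟩ := exists_lower_tail_le hqs
    (fun ω => Real.logb 2 (K ω.1 ω.2.1 ω.2.2 / outputLaw p V K ω.2.2)) hδ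
  rw [hq, ← entropy_joint_fst hV hK, ← hq] at h₁
  rw [hq, ← condMutualInfo_joint hp hV hK, ← hq] at h₂
  rw [hq, ← mutualInfo_joint hp hV hK, ← hq] at h₃
  refine ⟨C₁ + C₂ + C₃, fun k => ?_⟩
  rw [failProb]
  simp only [centreOutput_prod, outputLaw_prod]
  rw [add_div, add_div]
  refine (sum_prod_eq_sum_joint k (fun a x y => if (∏ b, p (a b)) ≤
      2 ^ (-((k : ℝ) * (entropy q (fun ω => ω.1) - δ))) ∧
      2 ^ ((k : ℝ) * (condMutualInfo q (fun ω => ω.2.1) (fun ω => ω.2.2) (fun ω => ω.1) - δ)) *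
        ∏ b, centreOutput V K (a b) (y b) < ∏ b, K (a b) (x b) (y b) ∧
      2 ^ ((k : ℝ) * (mutualInfo q (fun ω => (ω.1, ω.2.1)) (fun ω => ω.2.2) - δ)) *
        ∏ b, outputLaw p V K (y b) < ∏ b, K (a b) (x b) (y b) then (0 : ℝ) else 1)).trans_le ?_
  refine le_trans ?_ (add_le_add (add_le_add (h₁ k) (h₂ k)) (h₃ k))
  rw [← Finset.sum_add_distrib, ← Finset.sum_add_distrib]
  refine Finset.sum_le_sum fun ω _ => ?_
  rw [← mul_add, ← mul_add, ← hq]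
  have hprod : ∀ b, 0 ≤ q (ω b) := fun b => hqs.1 _
  -- Sequences of probability zero contribute nothing; on the others every ratio is positive, so
  -- sums of logarithms can be exponentiated.
  by_cases hpos : ∀ b, 0 < q (ω b)
  swap
  · push Not at hpos
    obtain ⟨b, hb⟩ := hpos
    rw [Finset.prod_eq_zero (Finset.mem_univ b) (le_antisymm hb (hprod b))]
    simp
  have hp' : ∀ b, 0 < p (ω b).1 := fun b => (hp.1 _).lt_of_ne' fun h => (hpos b).ne' (by
    simp [hq, joint, h])
  have hV' : ∀ b, 0 < V (ω b).1 (ω b).2.1 := fun b => ((hV _).1 _).lt_of_ne' fun h =>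
    (hpos b).ne' (by simp [hq, joint, h])
  have hK' : ∀ b, 0 < K (ω b).1 (ω b).2.1 (ω b).2.2 := fun b => ((hK _ _).1 _).lt_of_ne' fun h =>
    (hpos b).ne' (by simp [hq, joint, h])
  have hc : ∀ b, 0 < centreOutput V K (ω b).1 (ω b).2.2 := fun b =>
    (mul_pos (hV' b) (hK' b)).trans_le (Finset.single_le_sum
      (f := fun x => V (ω b).1 x * K (ω b).1 x (ω b).2.2)
      (fun x _ => mul_nonneg ((hV _).1 _) ((hK _ _).1 _)) (Finset.mem_univ (ω b).2.1))
  have ho : ∀ b, 0 < outputLaw p V K (ω b).2.2 := fun b =>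
    (mul_pos (mul_pos (hp' b) (hV' b)) (hK' b)).trans_le (Finset.single_le_sum
      (f := fun t : A × X => p t.1 * V t.1 t.2 * K t.1 t.2 (ω b).2.2)
      (fun t _ => mul_nonneg (mul_nonneg (hp.1 _) ((hV _).1 _)) ((hK _ _).1 _))
      (Finset.mem_univ ((ω b).1, (ω b).2.1)))
  refine mul_le_mul_of_nonneg_left ?_ (Finset.prod_nonneg fun b _ => hprod b)
  by_cases t₁ : ∑ b, -Real.logb 2 (p (ω b).1) ≤ k * (entropy q (fun ω => ω.1) - δ)
  · rw [if_pos t₁]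
    split_ifs <;> norm_num
  by_cases t₂ : ∑ b, Real.logb 2 (K (ω b).1 (ω b).2.1 (ω b).2.2 /
      centreOutput V K (ω b).1 (ω b).2.2) ≤
      k * (condMutualInfo q (fun ω => ω.2.1) (fun ω => ω.2.2) (fun ω => ω.1) - δ)
  · rw [if_pos t₂]
    split_ifs <;> norm_num
  by_cases t₃ : ∑ b, Real.logb 2 (K (ω b).1 (ω b).2.1 (ω b).2.2 / outputLaw p V K (ω b).2.2) ≤
      k * (mutualInfo q (fun ω => (ω.1, ω.2.1)) (fun ω => ω.2.2) - δ)
  · rw [if_pos t₃]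
    split_ifs <;> norm_num
  rw [if_pos]
  · rw [if_neg t₁, if_neg t₂, if_neg t₃]
    norm_num
  refine ⟨?_, ?_, ?_⟩
  · have := rpow_lt_prod (r := fun b => (p (ω b).1)⁻¹) (fun b => inv_pos.2 (hp' b))
      (t := k * (entropy q (fun ω => ω.1) - δ)) (by simpa [Real.logb_inv] using t₁)
    rw [Finset.prod_inv_distrib] at this
    rw [Real.rpow_neg (by norm_num)]
    exact (le_inv_comm₀ (Finset.prod_pos fun b _ => hp' b) (by positivity)).2 this.le
  · have := rpow_lt_prod (fun b => div_pos (hK' b) (hc b)) (not_le.1 t₂)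
    rwa [Finset.prod_div_distrib, lt_div_iff₀ (Finset.prod_pos fun b _ => hc b)] at this
  · have := rpow_lt_prod (fun b => div_pos (hK' b) (ho b)) (not_le.1 t₃)
    rwa [Finset.prod_div_distrib, lt_div_iff₀ (Finset.prod_pos fun b _ => ho b)] at this

end Block

/-! ### Block codes with vanishing error -/

section Direct

variable {A X B D : Type*} [Fintype A] [Fintype X] [Fintype B] [Fintype D]

/-- Of the gap `2 * δ` between rate and information, one `δ` is spent on the decoding threshold and
the other gives the exponential decay. -/
lemma pos_mul_rpow_le {c : ℝ} (hc : 0 ≤ c) {M k r h δ : ℝ} (hk : 0 ≤ k) (hM : M ≤ c * 2 ^ (k * r))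
    (hr : r ≤ h - 2 * δ) : M * 2 ^ (-(k * (h - δ))) ≤ c * 2 ^ (-(k * δ)) := by
  calc M * 2 ^ (-(k * (h - δ))) ≤ c * 2 ^ (k * r) * 2 ^ (-(k * (h - δ))) :=
        mul_le_mul_of_nonneg_right hM (by positivity)
    _ = c * 2 ^ (k * r + -(k * (h - δ))) := by rw [mul_assoc, ← Real.rpow_add (by norm_num)]
    _ ≤ c * 2 ^ (-(k * δ)) := by
        refine mul_le_mul_of_nonneg_left (Real.rpow_le_rpow_of_exponent_le (by norm_num) ?_) hc
        nlinarith

lemma tendsto_two_rpow_neg {δ : ℝ} (hδ : 0 < δ) :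
    Tendsto (fun k : ℕ => (2 : ℝ) ^ (-((k : ℝ) * δ))) atTop (𝓝 0) := by
  have h : Tendsto (fun k : ℕ => ((2 : ℝ) ^ (-δ)) ^ k) atTop (𝓝 0) :=
    tendsto_pow_atTop_nhds_zero_of_lt_one (by positivity)
      (Real.rpow_lt_one_of_one_lt_of_neg (by norm_num) (by linarith))
  refine h.congr fun k => ?_
  rw [← Real.rpow_natCast, ← Real.rpow_mul (by norm_num)]
  congr 1
  ring

/-- Codes for `k` uses of a finite family of channels, with an error probability tending to `0`
and the same code for all the channels. -/
lemma exists_block_codes [Nonempty X] {P : A × X → ℝ} (hP : P ∈ stdSimplex ℝ (A × X))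
    {K : D → A → X → B → ℝ} (hK : ∀ d a x, K d a x ∈ stdSimplex ℝ B) {c r₁ r₂ δ : ℝ}
    (hc : 0 ≤ c) (hδ : 0 < δ) (hr₂ : 0 ≤ r₂)
    (h₁ : r₁ = 0 ∨ ∀ d, r₁ ≤ entropy (joint P (K d)) (fun ω => ω.1) - 2 * δ)
    (h₂ : r₂ = 0 ∨ ∀ d, r₂ ≤
      condMutualInfo (joint P (K d)) (fun ω => ω.2.1) (fun ω => ω.2.2) (fun ω => ω.1) - 2 * δ)
    (h₁₂ : r₁ = 0 ∨ ∀ d, r₁ + r₂ ≤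
      mutualInfo (joint P (K d)) (fun ω => (ω.1, ω.2.1)) (fun ω => ω.2.2) - 2 * δ) :
    ∃ ε : ℕ → ℝ, Tendsto ε atTop (𝓝 0) ∧ ∀ k M₁ M₂ : ℕ, 0 < M₁ → 0 < M₂ →
      (r₁ = 0 → M₁ = 1) → (r₂ = 0 → M₂ = 1) →
      (M₁ : ℝ) - 1 ≤ c * 2 ^ (k * r₁) → (M₂ : ℝ) - 1 ≤ c * 2 ^ (k * r₂) →
      ∃ (f₁ : Fin M₁ → Fin k → A) (f₂ : (Fin k → A) → Fin M₂ → Fin k → X)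
        (g : (Fin k → B) → Fin M₁ × Fin M₂), ∀ d,
        1 / ((M₁ : ℝ) * M₂) * ∑ m₁, ∑ m₂, ∑ y : Fin k → B,
          (if g y ≠ (m₁, m₂) then ∏ b, K d (f₁ m₁ b) (f₂ (f₁ m₁) m₂ b) (y b) else 0) ≤ ε k := by
  classical
  obtain ⟨p, V, hp, hV, rfl⟩ := exists_disintegration hP
  choose C hC using fun d => exists_failProb_prod_le hp hV (hK d) hδ
  rcases isEmpty_or_nonempty D with hD | ⟨⟨d₀⟩⟩
  · refine ⟨fun _ => 0, tendsto_const_nhds, fun k M₁ M₂ hM₁ hM₂ _ _ _ _ => ?_⟩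
    have : Nonempty A := by
      by_contra h
      rw [not_nonempty_iff] at h
      simpa using hp.2
    exact ⟨fun _ _ => Classical.arbitrary A, fun _ _ _ => Classical.arbitrary X,
      fun _ => (⟨0, hM₁⟩, ⟨0, hM₂⟩), fun d => isEmptyElim d⟩
  set q : D → A × X × B → ℝ := fun d => joint (fun t => p t.1 * V t.1 t.2) (K d) with hq
  -- The law of the first input does not see the channel, so one collision threshold `c₁` serves all
  -- `d`.
  have hH : ∀ d, entropy (q d) (fun ω => ω.1) = entropy (q d₀) (fun ω => ω.1) := fun d => by
    simp only [hq, entropy]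
    simp only [law_joint_fst (hK _)]
  refine ⟨fun k => ∑ d : D, (C d / (k + 1) + (c + c * Fintype.card D +
    c * (c + 1) * Fintype.card D) * 2 ^ (-((k : ℝ) * δ))), ?_, ?_⟩
  · rw [show (0 : ℝ) = ∑ d : D, (0 + (c + c * Fintype.card D +
      c * (c + 1) * Fintype.card D) * 0) by simp]
    refine tendsto_finsetSum _ fun d _ => Tendsto.add ?_ ((tendsto_two_rpow_neg hδ).const_mul _)
    have := (tendsto_one_div_add_atTop_nhds_zero_nat (𝕜 := ℝ)).const_mul (C d)
    simpa [div_eq_mul_inv] using this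
  intro k M₁ M₂ hM₁ hM₂ hz₁ hz₂ hb₁ hb₂
  have hk : (0 : ℝ) ≤ k := Nat.cast_nonneg k
  have hpk := prod_mem_stdSimplex (I := Fin k) (w := fun _ => p) fun _ => hp
  obtain ⟨f₁, f₂, g, hg⟩ := exists_superposition_code (A := Fin k → A) (X := Fin k → X)
    (B := Fin k → B) (D := D) hpk (V := fun a x => ∏ b, V (a b) (x b))
    (fun a => prod_mem_stdSimplex fun b => hV (a b))
    (K := fun d a x y => ∏ b, K d (a b) (x b) (y b))
    (fun d a x => prod_mem_stdSimplex fun b => hK d (a b) (x b))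
    (c₁ := 2 ^ (-((k : ℝ) * (entropy (q d₀) (fun ω => ω.1) - δ))))
    (c₂ := fun d => 2 ^ ((k : ℝ) * (condMutualInfo (q d)
          (fun ω => ω.2.1) (fun ω => ω.2.2) (fun ω => ω.1) - δ)))
    (c₁₂ := fun d => 2 ^ ((k : ℝ) * (mutualInfo (q d)
          (fun ω => (ω.1, ω.2.1)) (fun ω => ω.2.2) - δ)))
    (by positivity) (fun d => by positivity) (fun d => by positivity) hM₁ hM₂
  refine ⟨f₁, f₂, g, fun d => (hg d).trans (Finset.sum_le_sum fun d' _ => add_le_add ?_ ?_)⟩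
  · have := hC d' k
    rw [← hH d']
    exact this
  have h2 : (0 : ℝ) < 2 ^ (-((k : ℝ) * δ)) := by positivity
  have hM₁' : (0 : ℝ) ≤ M₁ - 1 := by
    have : (1 : ℝ) ≤ M₁ := by exact_mod_cast hM₁
    linarith
  have hM₂' : (0 : ℝ) ≤ M₂ - 1 := by
    have : (1 : ℝ) ≤ M₂ := by exact_mod_cast hM₂
    linarith
  have t₁ : ((M₁ : ℝ) - 1) * 2 ^ (-((k : ℝ) * (entropy (q d₀) (fun ω => ω.1) - δ))) ≤
      c * 2 ^ (-((k : ℝ) * δ)) := by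
    -- At rate zero there is a single message, so the factor `M₁ - 1` vanishes and no information
    -- bound is needed. The alternative matters because a rate cut off at zero need not leave a gap
    -- of `2 * δ`.
    rcases h₁ with h₁ | h₁
    · rw [hz₁ h₁, Nat.cast_one, sub_self, zero_mul]
      positivity
    · exact pos_mul_rpow_le hc hk hb₁ (h₁ d₀)
  have t₂ : ((M₂ : ℝ) - 1) * ∑ d, 1 / (2 : ℝ) ^ ((k : ℝ) * (condMutualInfo (q d)
      (fun ω => ω.2.1) (fun ω => ω.2.2) (fun ω => ω.1) - δ)) ≤
      c * Fintype.card D * 2 ^ (-((k : ℝ) * δ)) := by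
    rw [Finset.mul_sum, show c * Fintype.card D * (2 : ℝ) ^ (-((k : ℝ) * δ)) =
      ∑ d : D, c * (2 : ℝ) ^ (-((k : ℝ) * δ)) by
        rw [Finset.sum_const, nsmul_eq_mul, Finset.card_univ]; ring]
    refine Finset.sum_le_sum fun d _ => ?_
    rcases h₂ with h₂ | h₂
    · rw [hz₂ h₂, Nat.cast_one, sub_self, zero_mul]
      positivity
    · rw [one_div, ← Real.rpow_neg (by norm_num)]
      exact pos_mul_rpow_le hc hk hb₂ (h₂ d)
  have t₃ : ((M₁ : ℝ) - 1) * M₂ * ∑ d, 1 / (2 : ℝ) ^ ((k : ℝ) * (mutualInfo (q d)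
      (fun ω => (ω.1, ω.2.1)) (fun ω => ω.2.2) - δ)) ≤
      c * (c + 1) * Fintype.card D * 2 ^ (-((k : ℝ) * δ)) := by
    rw [Finset.mul_sum, show c * (c + 1) * Fintype.card D * (2 : ℝ) ^ (-((k : ℝ) * δ)) =
      ∑ d : D, c * (c + 1) * (2 : ℝ) ^ (-((k : ℝ) * δ)) by
        rw [Finset.sum_const, nsmul_eq_mul, Finset.card_univ]; ring]
    refine Finset.sum_le_sum fun d _ => ?_
    rcases h₁₂ with h₁ | h₁₂
    · rw [hz₁ h₁, Nat.cast_one, sub_self, zero_mul, zero_mul]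
      positivity
    · rw [one_div, ← Real.rpow_neg (by norm_num)]
      refine pos_mul_rpow_le (by positivity) hk ?_ (h₁₂ d)
      -- This term contains `M₂` rather than `M₂ - 1`; the missing 1 is absorbed since `2 ^ (k * r₂)
      -- ≥ 1`.
      have h3 : (M₂ : ℝ) ≤ (c + 1) * 2 ^ ((k : ℝ) * r₂) := by
        have : (1 : ℝ) ≤ 2 ^ ((k : ℝ) * r₂) := Real.one_le_rpow (by norm_num) (by positivity)
        linarith
      calc ((M₁ : ℝ) - 1) * M₂ ≤ (c * 2 ^ ((k : ℝ) * r₁)) * ((c + 1) * 2 ^ ((k : ℝ) * r₂)) :=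
            mul_le_mul hb₁ h3 (Nat.cast_nonneg _) (by positivity)
        _ = c * (c + 1) * 2 ^ ((k : ℝ) * (r₁ + r₂)) := by
            rw [mul_add (k : ℝ), Real.rpow_add (by norm_num)]
            ring
  linarith

end Direct

/-! ### Sub-blocks of a long block -/

section Embedding

variable {X₁ X₂ Y : Type*} {dmin dmax : ℕ}

/-- The time `b * n + i` of the `i`-th symbol of the `b`-th block of length `n`. -/
def blockTime {n k N : ℕ} (h : k * n ≤ N) (t : Fin k × Fin n) : Fin N :=
  ⟨t.1 * n + t.2, by
    have h1 : (t.1 : ℕ) + 1 ≤ k := t.1.2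
    have h2 := t.2.2
    have h3 := Nat.mul_le_mul_right n h1
    rw [Nat.add_mul, Nat.one_mul] at h3
    omega⟩

lemma blockTime_injective {n k N : ℕ} (h : k * n ≤ N) :
    Function.Injective (blockTime h) := by
  rintro ⟨b, i⟩ ⟨b', i'⟩ e
  have e' : (b : ℕ) * n + i = b' * n + i' := by simpa [blockTime] using e
  have hn : 0 < n := i.pos
  have hb : (b : ℕ) = b' := by
    have := congrArg (· / n) e'
    simpa [Nat.add_comm, Nat.add_mul_div_right _ _ hn, Nat.div_eq_of_lt i.2,
      Nat.div_eq_of_lt i'.2] using this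
  have hi : (i : ℕ) = i' := by
    rw [hb] at e'
    omega
  rw [Fin.ext hb, Fin.ext hi]

variable [Fintype X₁] [Fintype X₂] [Fintype Y]
  {W : X₁ → X₂ → Y → ℝ}

lemma transProb_mem_stdSimplex (hW : ∀ x₁ x₂, W x₁ x₂ ∈ stdSimplex ℝ Y)
    (σ : FillRule X₁ X₂ dmin dmax) (n : ℕ) (d : Delay dmin dmax)
    (x₁ : Fin n → X₁) (x₂ : Fin n → X₂) :
    transProb W σ n d x₁ x₂ ∈ stdSimplex ℝ (Fin n → Y) :=
  prod_mem_stdSimplex fun _ => hW _ _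

lemma windowTransProb_mem_stdSimplex (hW : ∀ x₁ x₂, W x₁ x₂ ∈ stdSimplex ℝ Y)
    (n : ℕ) (d : Delay dmin dmax)
    (x₁ : Fin n → X₁) (x₂ : Fin n → X₂) :
    windowTransProb W n d x₁ x₂ ∈ stdSimplex ℝ (Window n dmin dmax → Y) :=
  prod_mem_stdSimplex fun _ => hW _ _

/-- For a time in the window of a sub-block, the delayed time lies in the same sub-block. Hence the
retained outputs involve no filled symbol and no symbol of another sub-block, and the remaining
outputs sum out. The right side is free of `σ`, which gives uniformity over all filling rules. -/
lemma sum_transProb_blocks (hW : ∀ x₁ x₂, W x₁ x₂ ∈ stdSimplex ℝ Y)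
    (σ : FillRule X₁ X₂ dmin dmax) {n k N : ℕ} (h : k * n ≤ N)
    (d : Delay dmin dmax) {x₁ : Fin N → X₁} {x₂ : Fin N → X₂} {a : Fin k → Fin n → X₁}
    {x : Fin k → Fin n → X₂} (ha : ∀ b i, x₁ (blockTime h (b, i)) = a b i)
    (hx : ∀ b i, x₂ (blockTime h (b, i)) = x b i)
    (F : (Fin k → Window n dmin dmax → Y) → ℝ) :
    ∑ y, transProb W σ N d x₁ x₂ y * F (fun b w => y (blockTime h (b, w.1))) =
      ∑ z, (∏ b, windowTransProb W n d (a b) (x b) (z b)) * F z := by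
  have he : Function.Injective
      fun t : Fin k × Window n dmin dmax => blockTime h (t.1, t.2.1) := by
    rintro ⟨b, w⟩ ⟨b', w'⟩ e
    have := blockTime_injective h e
    simp only [Prod.mk.injEq] at this
    rw [this.1, Subtype.ext this.2]
  simp only [transProb]
  rw [sum_prod_comp he (w := fun i : Fin N =>
    W (symbolAt x₁ (σ N d x₁ x₂) ((i : ℤ) - (d : ℤ))) (x₂ i)) (fun i => (hW _ _).2)
    (fun z => F fun b w => z (b, w))]
  refine Fintype.sum_equiv (Equiv.curry _ _ _) _ _ fun z => ?_
  congr 1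
  rw [Fintype.prod_prod_type]
  refine Finset.prod_congr rfl fun b _ => ?_
  rw [windowTransProb]
  refine Finset.prod_congr rfl fun w _ => ?_
  have h1 : (blockTime h (b, w.delayed d) : ℤ) = (blockTime h (b, w.1) : ℤ) - (d : ℤ) := by
    have h2 := w.2.1
    have h3 := w.2.2
    have h4 := d.2.1
    have h5 := d.2.2
    simp only [blockTime, Window.delayed]
    push_cast
    rw [Int.toNat_of_nonneg (by omega)]
    ring
  have h2 : symbolAt x₁ (σ N d x₁ x₂) ((blockTime h (b, w.1) : ℤ) - (d : ℤ)) =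
      a b (w.delayed d) := by
    rw [← h1, symbolAt, dif_pos ⟨Int.natCast_nonneg _, by exact_mod_cast (blockTime h _).2⟩]
    simp [ha]
  rw [h2, hx]
  rfl

end Embedding

/-! ### Achievability of the window regions -/

section Achievability

variable {X₁ X₂ Y : Type*} {dmin dmax : ℕ} [Fintype X₁] [Fintype X₂] [Fintype Y]
  {W : X₁ → X₂ → Y → ℝ}

lemma numMessages_pos (n : ℕ) (R : ℝ) : 0 < numMessages n R :=
  Nat.ceil_pos.2 (by positivity)

lemma numMessages_zero (n : ℕ) : numMessages n 0 = 1 := by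
  simp [numMessages]

lemma numMessages_sub_one_le (n : ℕ) (R : ℝ) : (numMessages n R : ℝ) - 1 ≤ 2 ^ ((n : ℝ) * R) := by
  have := Nat.ceil_lt_add_one (a := (2 : ℝ) ^ ((n : ℝ) * R)) (by positivity)
  rw [numMessages]
  linarith

/-- At most one incomplete sub-block is lost, which costs a factor independent of `N`. -/
lemma two_rpow_le_blocks {n : ℕ} (hn : 0 < n) (N : ℕ) {R : ℝ} (hR : 0 ≤ R) :
    (2 : ℝ) ^ ((N : ℝ) * R) ≤ 2 ^ ((n : ℝ) * R) * 2 ^ (((N / n : ℕ) : ℝ) * (n * R)) := by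
  rw [← Real.rpow_add (by norm_num)]
  refine Real.rpow_le_rpow_of_exponent_le (by norm_num) ?_
  have h1 : N ≤ n + (N / n) * n := by
    have := Nat.div_add_mod N n
    have := Nat.mod_lt N hn
    nlinarith
  have h2 : (N : ℝ) ≤ n + ((N / n : ℕ) : ℝ) * n := by exact_mod_cast h1
  calc (N : ℝ) * R ≤ (n + ((N / n : ℕ) : ℝ) * n) * R := mul_le_mul_of_nonneg_right h2 hR
    _ = _ := by ring

/-- Codes for the windows of `k` blocks of length `n` give codes of length `N ≥ k * n`. -/
lemma exists_code_of_blocks [Nonempty X₁] [Nonempty X₂] (hW : ∀ x₁ x₂, W x₁ x₂ ∈ stdSimplex ℝ Y)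
    {n k N M₁ M₂ : ℕ} (h : k * n ≤ N)
    (f₁ : Fin M₁ → Fin k → Fin n → X₁) (f₂ : (Fin k → Fin n → X₁) → Fin M₂ → Fin k → Fin n → X₂)
    (g : (Fin k → Window n dmin dmax → Y) → Fin M₁ × Fin M₂) :
    ∃ c : ACCMACCode X₁ X₂ Y N M₁ M₂, ∀ (σ : FillRule X₁ X₂ dmin dmax) (d : Delay dmin dmax),
      c.errorProb W σ d = 1 / ((M₁ : ℝ) * M₂) * ∑ m₁, ∑ m₂,
        ∑ z : Fin k → Window n dmin dmax → Y, (if g z ≠ (m₁, m₂) then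
          ∏ b, windowTransProb W n d (f₁ m₁ b) (f₂ (f₁ m₁) m₂ b) (z b) else 0) := by
  have hinj := blockTime_injective h
  set e₁ : (Fin k → Fin n → X₁) → Fin N → X₁ := fun a =>
    Function.extend (blockTime h) (fun t => a t.1 t.2) (fun _ => Classical.arbitrary X₁) with he₁
  set e₂ : (Fin k → Fin n → X₂) → Fin N → X₂ := fun x =>
    Function.extend (blockTime h) (fun t => x t.1 t.2) (fun _ => Classical.arbitrary X₂) with he₂
  have h₁ : ∀ a b i, e₁ a (blockTime h (b, i)) = a b i := fun a b i => hinj.extend_apply _ _ _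
  have h₂ : ∀ x b i, e₂ x (blockTime h (b, i)) = x b i := fun x b i => hinj.extend_apply _ _ _
  -- The informed encoder recovers the sub-blocks by reading the codeword at the block times.
  -- Leftover times carry a fixed symbol and the decoder ignores them.
  refine ⟨⟨fun m₁ => e₁ (f₁ m₁), fun z m₂ => e₂ (f₂ (fun b i => z (blockTime h (b, i))) m₂),
    fun y => g fun b w => y (blockTime h (b, w.1))⟩, fun σ d => ?_⟩
  rw [ACCMACCode.errorProb, ACMACCode.errorProb]
  simp only [ACCMACCode.toACMAC, h₁]
  congr 1
  refine Finset.sum_congr rfl fun m₁ _ => Finset.sum_congr rfl fun m₂ _ => ?_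
  have := sum_transProb_blocks hW σ h d (h₁ (f₁ m₁)) (h₂ (f₂ (f₁ m₁) m₂))
    (fun z => if g z ≠ (m₁, m₂) then 1 else 0)
  simpa only [mul_ite, mul_one, mul_zero] using this

/-- The block codes are used with `N / n` sub-blocks, each one letter of the vector channel, for
every length `N`. The loss `η` per symbol is `n * η` per sub-block, which is `2 * δ` for `δ = n * η
/ 2`. -/
lemma achievable_of_mem_regionQ [Nonempty X₁] [Nonempty X₂]
    (hW : ∀ x₁ x₂, W x₁ x₂ ∈ stdSimplex ℝ Y) (S : Set (FillRule X₁ X₂ dmin dmax)) {n : ℕ}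
    (hn : 0 < n) {R : ℝ × ℝ} (hR : R ∈ regionQ W dmin dmax n) {η : ℝ} (hη : 0 < η) :
    ACCMACAchievable W S (max (R.1 - η) 0, max (R.2 - η) 0) := by
  refine ⟨le_max_right _ _, le_max_right _ _, ?_⟩
  simp only [regionQ, Set.mem_iUnion, Set.mem_iInter] at hR
  obtain ⟨P, hP, hR⟩ := hR
  set R₁ := max (R.1 - η) 0 with hR₁
  set R₂ := max (R.2 - η) 0 with hR₂
  have hn' : (0 : ℝ) < n := by exact_mod_cast hn
  have hR₁0 : 0 ≤ R₁ := le_max_right _ _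
  have hR₂0 : 0 ≤ R₂ := le_max_right _ _
  have c₁ : R₁ = 0 ∨ R₁ = R.1 - η := (max_choice _ _).symm
  have c₂ : R₂ = 0 ∨ R₂ = R.2 - η := (max_choice _ _).symm
  have key : ∀ {r t : ℝ}, r ≤ 1 / (n : ℝ) * t → ∀ {s}, s ≤ r - η →
      n * s ≤ t - 2 * (n * η / 2) := by
    intro r t h s hs
    rw [one_div, inv_mul_eq_div, le_div_iff₀ hn'] at h
    nlinarith
  obtain ⟨ε, hε, hcode⟩ := exists_block_codes (D := Delay dmin dmax) hP
    (fun d x₁ x₂ => windowTransProb_mem_stdSimplex hW n d x₁ x₂)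
    (c := 2 ^ ((n : ℝ) * R₁) + 2 ^ ((n : ℝ) * R₂)) (r₁ := n * R₁) (r₂ := n * R₂)
    (δ := n * η / 2) (by positivity) (by positivity) (by positivity)
    (c₁.imp (fun h => by rw [h, mul_zero]) fun h d => key (hR d).2.2.1 h.le)
    (c₂.imp (fun h => by rw [h, mul_zero]) fun h d => key (hR d).2.2.2.1 h.le)
    (c₁.imp (fun h => by rw [h, mul_zero]) fun h d => by
      rw [← mul_add]
      refine key (hR d).2.2.2.2 ?_
      -- The second rate may have been cut off at zero, but the `η` lost by the first already
      -- suffices for the sum.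
      have : R₂ ≤ R.2 := max_le (by linarith) (hR d).2.1
      linarith)
  have hlen : ∀ N : ℕ, N / n * n ≤ N := fun N => Nat.div_mul_le_self N n
  have hex : ∀ N : ℕ, ∃ c : ACCMACCode X₁ X₂ Y N (numMessages N R₁) (numMessages N R₂),
      ∀ (σ : FillRule X₁ X₂ dmin dmax) (d : Delay dmin dmax), c.errorProb W σ d ≤ ε (N / n) := by
    intro N
    have b₁ := (numMessages_sub_one_le N R₁).trans (two_rpow_le_blocks hn N hR₁0)
    have b₂ := (numMessages_sub_one_le N R₂).trans (two_rpow_le_blocks hn N hR₂0)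
    obtain ⟨f₁, f₂, g, hg⟩ := hcode (N / n) (numMessages N R₁) (numMessages N R₂)
      (numMessages_pos _ _) (numMessages_pos _ _)
      (fun h => by rw [(mul_eq_zero.1 h).resolve_left hn'.ne', numMessages_zero])
      (fun h => by rw [(mul_eq_zero.1 h).resolve_left hn'.ne', numMessages_zero])
      (b₁.trans (mul_le_mul_of_nonneg_right (le_add_of_nonneg_right (by positivity))
        (by positivity)))
      (b₂.trans (mul_le_mul_of_nonneg_right (le_add_of_nonneg_left (by positivity))
        (by positivity)))
    obtain ⟨c, hc⟩ := exists_code_of_blocks (dmin := dmin) (dmax := dmax) hW (hlen N) f₁ f₂ g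
    exact ⟨c, fun σ d => (hc σ d).trans_le (hg d)⟩
  choose c hc using hex
  exact ⟨c, fun N => ε (N / n), hε.comp (Nat.tendsto_div_const_atTop hn.ne'),
    fun N d σ _ => hc N σ d⟩

end Achievability

/-! ### Converse by Fano's inequality -/

section Converse

lemma law_joint_fst_output {A X B : Type*} [Fintype A] [Fintype X] [Fintype B] {P : A × X → ℝ}
    {K : A → X → B → ℝ} (a : A) (y : B) :
    law (joint P K) (fun ω => (ω.1, ω.2.2)) (a, y) = ∑ x, P (a, x) * K a x y := by
  classical
  simp only [law, joint, Fintype.sum_prod_type]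
  rw [Finset.sum_eq_single a]
  · refine Finset.sum_congr rfl fun x _ => ?_
    simp
  · intro a' _ h
    simp [h]
  · simp

variable {Ω A X B : Type*} [Fintype Ω] [Fintype A] [Fintype X] [Fintype B]

lemma joint_eq_law {q : Ω → ℝ} {X₁ : Ω → A} {X₂ : Ω → X} {Y : Ω → B} {P : A × X → ℝ}
    {K : A → X → B → ℝ} (h : ∀ t y, law q (fun ω => ((X₁ ω, X₂ ω), Y ω)) (t, y) =
      P t * K t.1 t.2 y) :
    joint P K = law q (fun ω => (X₁ ω, X₂ ω, Y ω)) := by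
  funext ⟨a, x, y⟩
  rw [joint, ← h (a, x) y, law, law]
  refine Finset.sum_congr rfl fun ω _ => ?_
  split_ifs with h₁ h₂ h₂
  · rfl
  · exact absurd (by simpa [and_assoc] using h₁) h₂
  · exact absurd (by simpa [and_assoc] using h₂) h₁
  · rfl

variable {X₁ X₂ Y : Type*} {dmin dmax : ℕ} [Fintype X₁] [Fintype X₂] [Fintype Y]
  {W : X₁ → X₂ → Y → ℝ} {n M₁ M₂ : ℕ}

/-- The law of the words sent for uniformly distributed messages. -/
noncomputable def ACCMACCode.inputLaw (c : ACCMACCode X₁ X₂ Y n M₁ M₂) :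
    (Fin n → X₁) × (Fin n → X₂) → ℝ :=
  law (fun _ : Fin M₁ × Fin M₂ => 1 / ((M₁ : ℝ) * M₂))
    (fun m => (c.enc₁ m.1, c.enc₂ (c.enc₁ m.1) m.2))

lemma uniform_mem_stdSimplex (hM₁ : 0 < M₁) (hM₂ : 0 < M₂) :
    (fun _ : Fin M₁ × Fin M₂ => 1 / ((M₁ : ℝ) * M₂)) ∈ stdSimplex ℝ (Fin M₁ × Fin M₂) := by
  refine ⟨fun _ => by positivity, ?_⟩
  rw [Finset.sum_const, Finset.card_univ, Fintype.card_prod, Fintype.card_fin, Fintype.card_fin,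
    nsmul_eq_mul]
  push_cast
  field_simp

lemma ACCMACCode.inputLaw_mem_stdSimplex (c : ACCMACCode X₁ X₂ Y n M₁ M₂) (hM₁ : 0 < M₁)
    (hM₂ : 0 < M₂) : c.inputLaw ∈ stdSimplex ℝ ((Fin n → X₁) × (Fin n → X₂)) :=
  law_mem_stdSimplex (uniform_mem_stdSimplex hM₁ hM₂) _

lemma ACCMACCode.errorProb_nonneg (hW : ∀ x₁ x₂, W x₁ x₂ ∈ stdSimplex ℝ Y)
    (c : ACCMACCode X₁ X₂ Y n M₁ M₂) (σ : FillRule X₁ X₂ dmin dmax) (d : Delay dmin dmax) :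
    0 ≤ c.errorProb W σ d := by
  refine mul_nonneg (by positivity) (Finset.sum_nonneg fun m₁ _ => Finset.sum_nonneg fun m₂ _ =>
    Finset.sum_nonneg fun y _ => ?_)
  split_ifs
  · exact (transProb_mem_stdSimplex hW σ n d _ _).1 y
  · exact le_rfl

lemma ACCMACCode.errorProb_eq (c : ACCMACCode X₁ X₂ Y n M₁ M₂) (σ : FillRule X₁ X₂ dmin dmax)
    (d : Delay dmin dmax) : c.errorProb W σ d =
      1 / ((M₁ : ℝ) * (M₂ : ℝ)) * ∑ m₁, ∑ m₂, ∑ y : Fin n → Y, if c.dec y ≠ (m₁, m₂) then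
        transProb W σ n d (c.enc₁ m₁) (c.enc₂ (c.enc₁ m₁) m₂) y else 0 := rfl

/-- The message entropies are computed exactly. The two Markov chains turn conditional entropies of
the output given messages into those given codewords, and the excess in each bound is at most the
equivocation `H(M₁, M₂ | Y)`, which Fano's inequality controls. -/
lemma ACCMACCode.converse (hW : ∀ x₁ x₂, W x₁ x₂ ∈ stdSimplex ℝ Y)
    (c : ACCMACCode X₁ X₂ Y n M₁ M₂) (hM₁ : 0 < M₁) (hM₂ : 0 < M₂)
    (σ : FillRule X₁ X₂ dmin dmax) (d : Delay dmin dmax) :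
    Real.logb 2 M₁ ≤ entropy (joint c.inputLaw (transProb W σ n d)) (fun ω => ω.1) +
      (1 + c.errorProb W σ d * Real.logb 2 (M₁ * M₂)) ∧
    Real.logb 2 M₂ ≤ condMutualInfo (joint c.inputLaw (transProb W σ n d))
      (fun ω => ω.2.1) (fun ω => ω.2.2) (fun ω => ω.1) +
      (1 + c.errorProb W σ d * Real.logb 2 (M₁ * M₂)) ∧
    Real.logb 2 M₁ + Real.logb 2 M₂ ≤ mutualInfo (joint c.inputLaw (transProb W σ n d))
      (fun ω => (ω.1, ω.2.1)) (fun ω => ω.2.2) +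
      (1 + c.errorProb W σ d * Real.logb 2 (M₁ * M₂)) := by
  classical
  have hM₁' : (0 : ℝ) < M₁ := by exact_mod_cast hM₁
  have hM₂' : (0 : ℝ) < M₂ := by exact_mod_cast hM₂
  set u : Fin M₁ × Fin M₂ → ℝ := fun _ => 1 / ((M₁ : ℝ) * M₂) with hu
  have hus : u ∈ stdSimplex ℝ _ := uniform_mem_stdSimplex hM₁ hM₂
  set k : Fin M₁ → Fin M₂ → (Fin n → Y) → ℝ := fun m₁ m₂ =>
    transProb W σ n d (c.enc₁ m₁) (c.enc₂ (c.enc₁ m₁) m₂) with hk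
  have hks : ∀ m₁ m₂, k m₁ m₂ ∈ stdSimplex ℝ _ := fun m₁ m₂ =>
    transProb_mem_stdSimplex hW σ n d _ _
  set q := joint u k with hq
  have hqs : q ∈ stdSimplex ℝ _ := joint_mem_stdSimplex hus hks
  set φ : Fin M₁ × Fin M₂ → (Fin n → X₁) × (Fin n → X₂) := fun m =>
    (c.enc₁ m.1, c.enc₂ (c.enc₁ m.1) m.2) with hφ
  have hlawU : law q (fun ω => (ω.1, ω.2.1)) = u := law_joint_inputs hks
  have hlaw₁ : ∀ m₁, law q (fun ω => ω.1) m₁ = 1 / M₁ := fun m₁ => by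
    rw [hq, law_joint_fst hks]
    simp only [hu, Finset.sum_const, Finset.card_univ, Fintype.card_fin, nsmul_eq_mul]
    field_simp
  -- the two Markov chains
  have hUY : ∀ m y, law q (fun ω => ((ω.1, ω.2.1), ω.2.2)) (m, y) =
      law q (fun ω => (ω.1, ω.2.1)) m * transProb W σ n d (φ m).1 (φ m).2 y := by
    rintro ⟨m₁, m₂⟩ y
    rw [hq, law_joint_pair, ← hq, hlawU]
    rfl
  -- Codeword cognition enters here: the satellite depends on `m₁` only through `c.enc₁ m₁`, so
  -- averaging over `m₂` leaves a kernel in the codeword. With message cognition this would fail.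
  have h1Y : ∀ m₁ y, law q (fun ω => (ω.1, ω.2.2)) (m₁, y) = law q (fun ω => ω.1) m₁ *
      (fun x₁ y => ∑ m₂ : Fin M₂, 1 / (M₂ : ℝ) * transProb W σ n d x₁ (c.enc₂ x₁ m₂) y)
        (c.enc₁ m₁) y := by
    intro m₁ y
    rw [hlaw₁, hq, law_joint_fst_output, Finset.mul_sum]
    refine Finset.sum_congr rfl fun m₂ _ => ?_
    simp only [hu, hk]
    field_simp
  have mk₁ := entropy_pair_sub_comp hqs.1 (fun ω => (ω.1, ω.2.1)) (fun ω => ω.2.2) φ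
    (fun t => transProb W σ n d t.1 t.2) hUY
  have mk₂ := entropy_pair_sub_comp hqs.1 (fun ω => ω.1) (fun ω => ω.2.2) c.enc₁
    (fun x₁ y => ∑ m₂ : Fin M₂, 1 / (M₂ : ℝ) * transProb W σ n d x₁ (c.enc₂ x₁ m₂) y) h1Y
  have hjoint : joint c.inputLaw (transProb W σ n d) = law q (fun ω => (c.enc₁ ω.1,
      c.enc₂ (c.enc₁ ω.1) ω.2.1, ω.2.2)) := by
    refine joint_eq_law (X₁ := fun ω : Fin M₁ × Fin M₂ × (Fin n → Y) => c.enc₁ ω.1)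
      (X₂ := fun ω => c.enc₂ (c.enc₁ ω.1) ω.2.1) (Y := fun ω => ω.2.2) fun t y => ?_
    have h := law_pair_comp (q := q) (fun ω => (ω.1, ω.2.1)) (fun ω => ω.2.2) φ
      (fun t => transProb W σ n d t.1 t.2) hUY t y
    rw [← law_law q (fun ω => (ω.1, ω.2.1)) φ, hlawU] at h
    exact h
  have hHU : entropy q (fun ω => (ω.1, ω.2.1)) = Real.logb 2 M₁ + Real.logb 2 M₂ := by
    rw [entropy_eq_sum, hlawU]
    simp only [hu]
    rw [← Finset.sum_mul, hqs.2, one_mul, one_div, Real.logb_inv, neg_neg,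
      Real.logb_mul hM₁'.ne' hM₂'.ne']
  have hH1 : entropy q (fun ω => ω.1) = Real.logb 2 M₁ := by
    rw [entropy_eq_sum]
    simp only [hlaw₁]
    rw [← Finset.sum_mul, hqs.2, one_mul, one_div, Real.logb_inv, neg_neg]
  have hfano : entropy q (fun ω => ((ω.1, ω.2.1), ω.2.2)) - entropy q (fun ω => ω.2.2) ≤
      1 + c.errorProb W σ d * Real.logb 2 (M₁ * M₂) := by
    have h := fano hqs (fun ω => (ω.1, ω.2.1)) (fun ω => ω.2.2) c.dec
    have e : (∑ ω, if c.dec ω.2.2 ≠ (ω.1, ω.2.1) then q ω else 0) = c.errorProb W σ d := by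
      rw [ACCMACCode.errorProb_eq]
      simp only [Finset.mul_sum, Fintype.sum_prod_type]
      refine Finset.sum_congr rfl fun m₁ _ => Finset.sum_congr rfl fun m₂ _ =>
        Finset.sum_congr rfl fun y _ => ?_
      simp only [hq, joint, hu, hk]
      by_cases hd : c.dec y = (m₁, m₂)
      · rw [if_neg (not_not.2 hd), if_neg (not_not.2 hd), mul_zero]
      · rw [if_pos hd, if_pos hd]
    have e' : ((Fintype.card (Fin M₁ × Fin M₂) : ℕ) : ℝ) = M₁ * M₂ := by simp
    rw [e'] at h
    rw [← e]
    convert h using 4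
    split_ifs <;> rfl
  have m₁ : entropy q (fun ω => (ω.1, ω.2.2)) ≤ entropy q (fun ω => ((ω.1, ω.2.1), ω.2.2)) :=
    entropy_mono hqs.1 (by simp +contextual)
  have m₂ : entropy q (fun ω => ω.2.2) ≤ entropy q (fun ω => (c.enc₁ ω.1, ω.2.2)) :=
    entropy_mono hqs.1 (by simp +contextual)
  have m₃ : entropy q (fun ω => ω.2.2) ≤ entropy q (fun ω => (ω.1, ω.2.2)) :=
    entropy_mono hqs.1 (by simp +contextual)
  rw [hjoint, entropy_law, condMutualInfo_law, mutualInfo_law, condMutualInfo_eq_entropy hqs.1,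
    mutualInfo_eq_entropy hqs.1]
  have p₁ : entropy q (fun ω => (c.enc₂ (c.enc₁ ω.1) ω.2.1, c.enc₁ ω.1)) =
      entropy q (fun ω => φ (ω.1, ω.2.1)) :=
    entropy_congr hqs.1 (by simp [hφ, and_comm])
  have p₂ : entropy q (fun ω => (ω.2.2, c.enc₁ ω.1)) =
      entropy q (fun ω => (c.enc₁ ω.1, ω.2.2)) :=
    entropy_congr hqs.1 (by simp [and_comm])
  have p₃ : entropy q (fun ω => (c.enc₂ (c.enc₁ ω.1) ω.2.1, ω.2.2, c.enc₁ ω.1)) =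
      entropy q (fun ω => (φ (ω.1, ω.2.1), ω.2.2)) :=
    entropy_congr hqs.1 fun ω ω' => by
      simp only [hφ, Prod.mk.injEq]
      tauto
  have p₄ : entropy q (fun ω => (c.enc₁ ω.1, c.enc₂ (c.enc₁ ω.1) ω.2.1)) =
      entropy q (fun ω => φ (ω.1, ω.2.1)) := rfl
  have p₅ : entropy q (fun ω => ((c.enc₁ ω.1, c.enc₂ (c.enc₁ ω.1) ω.2.1), ω.2.2)) =
      entropy q (fun ω => (φ (ω.1, ω.2.1), ω.2.2)) := rfl
  refine ⟨?_, ?_, ?_⟩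
  · linarith
  · rw [p₁, p₂, p₃]
    linarith
  · rw [p₄, p₅]
    linarith

end Converse

/-! ### Nonnegativity and data processing -/

section Nonneg

variable {Ω A B C E F : Type*} [Fintype Ω] [Fintype A] [Fintype B] [Fintype C] [Fintype E]
  [Fintype F] {q : Ω → ℝ}

lemma entropy_nonneg (hq : q ∈ stdSimplex ℝ Ω) (X : Ω → A) : 0 ≤ entropy q X := by
  rw [← entropy_const hq ()]
  exact entropy_mono hq.1 fun _ _ _ => rfl

lemma mutualInfo_nonneg (hq : q ∈ stdSimplex ℝ Ω) (X : Ω → A) (Y : Ω → B) :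
    0 ≤ mutualInfo q X Y := by
  rw [mutualInfo_eq_entropy hq.1]
  linarith [entropy_pair_le hq X Y]

lemma condMutualInfo_nonneg (hq : q ∈ stdSimplex ℝ Ω) (X : Ω → A) (Y : Ω → B) (Z : Ω → C) :
    0 ≤ condMutualInfo q X Y Z := by
  rw [condMutualInfo_eq_entropy hq.1]
  linarith [entropy_submodular hq X Y Z]

/-- Lets the conditional inequalities below serve for the unconditional information too. -/
lemma condMutualInfo_unit (hq : q ∈ stdSimplex ℝ Ω) (X : Ω → A) (Y : Ω → B) :
    condMutualInfo q X Y (fun _ => ()) = mutualInfo q X Y := by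
  rw [condMutualInfo_eq_entropy hq.1, mutualInfo_eq_entropy hq.1, entropy_const hq,
    entropy_congr hq.1 (X := X) (Y := fun ω => (X ω, ())) (by simp),
    entropy_congr hq.1 (X := Y) (Y := fun ω => (Y ω, ())) (by simp),
    entropy_congr hq.1 (X := fun ω => (X ω, Y ω)) (Y := fun ω => (X ω, Y ω, ())) (by simp)]
  ring

/-- The data processing inequality. -/
lemma condMutualInfo_comp_le (hq : q ∈ stdSimplex ℝ Ω) (X : Ω → A) (Y : Ω → B) (Z : Ω → C)
    (f : B → E) : condMutualInfo q X (fun ω => f (Y ω)) Z ≤ condMutualInfo q X Y Z := by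
  rw [condMutualInfo_eq_entropy hq.1, condMutualInfo_eq_entropy hq.1]
  -- The difference of the two sides is the information between `X` and `Y` given `(f Y, Z)`.
  have h := entropy_submodular hq X Y (fun ω => (f (Y ω), Z ω))
  have h₁ : entropy q (fun ω => (X ω, Y ω, f (Y ω), Z ω)) = entropy q (fun ω => (X ω, Y ω, Z ω)) :=
    entropy_congr hq.1 fun ω ω' => by
      simp only [Prod.mk.injEq]
      exact ⟨fun h => ⟨h.1, h.2.1, h.2.2.2⟩, fun h => ⟨h.1, h.2.1, by rw [h.2.1], h.2.2⟩⟩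
  have h₂ : entropy q (fun ω => (Y ω, f (Y ω), Z ω)) = entropy q (fun ω => (Y ω, Z ω)) :=
    entropy_congr hq.1 fun ω ω' => by
      simp only [Prod.mk.injEq]
      exact ⟨fun h => ⟨h.1, h.2.2⟩, fun h => ⟨h.1, by rw [h.1], h.2⟩⟩
  linarith

/-- Dropping the part `r Y` of `Y` costs at most `H(r Y)`. -/
lemma condMutualInfo_le_comp_add (hq : q ∈ stdSimplex ℝ Ω) (X : Ω → A) (Y : Ω → B) (Z : Ω → C)
    (f : B → E) (r : B → F) (hfr : ∀ y y', f y = f y' → r y = r y' → y = y') :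
    condMutualInfo q X Y Z ≤
      condMutualInfo q X (fun ω => f (Y ω)) Z + Real.logb 2 (Fintype.card F) := by
  rw [condMutualInfo_eq_entropy hq.1, condMutualInfo_eq_entropy hq.1]
  have h₁ : entropy q (fun ω => (Y ω, Z ω)) ≤ entropy q (fun ω => (r (Y ω), f (Y ω), Z ω)) :=
    entropy_mono hq.1 fun ω ω' h => by
      simp only [Prod.mk.injEq] at h ⊢
      exact ⟨hfr _ _ h.2.1 h.1, h.2.2⟩
  have h₂ := entropy_pair_le hq (fun ω => r (Y ω)) (fun ω => (f (Y ω), Z ω))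
  have h₃ := entropy_le_logb_card hq (fun ω => r (Y ω))
  have h₄ : entropy q (fun ω => (X ω, f (Y ω), Z ω)) ≤ entropy q (fun ω => (X ω, Y ω, Z ω)) :=
    entropy_mono hq.1 fun ω ω' h => by
      simp only [Prod.mk.injEq] at h ⊢
      exact ⟨h.1, by rw [h.2.1], h.2.2⟩
  linarith

end Nonneg

/-! ### Small rate reductions -/

section Shrink

/-- Both rates decreased by `η`, but kept nonnegative. -/
noncomputable def shrink (η : ℝ) (R : ℝ × ℝ) : ℝ × ℝ := (max (R.1 - η) 0, max (R.2 - η) 0)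

lemma shrink_shrink {η η' : ℝ} (hη' : 0 ≤ η') (R : ℝ × ℝ) :
    shrink η' (shrink η R) = shrink (η + η') R := by
  have h : ∀ a : ℝ, max (max (a - η) 0 - η') 0 = max (a - (η + η')) 0 := fun a => by
    rcases le_total (a - η) 0 with h | h
    · rw [max_eq_right h, max_eq_right (by linarith), max_eq_right (by linarith)]
    · rw [max_eq_left h, sub_sub]
  simp only [shrink, h]

lemma mem_closure_of_shrink_mem {T : Set (ℝ × ℝ)} {R : ℝ × ℝ} (h₁ : 0 ≤ R.1) (h₂ : 0 ≤ R.2)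
    (h : ∀ η > 0, shrink η R ∈ T) : R ∈ closure T := by
  have ht : Tendsto (fun η => shrink η R) (𝓝[>] 0) (𝓝 R) := by
    have hc : Continuous fun η => shrink η R := by
      unfold shrink
      fun_prop
    have h0 : shrink 0 R = R := by
      simp [shrink, h₁, h₂]
    have := hc.tendsto 0
    rw [h0] at this
    exact this.mono_left nhdsWithin_le_nhds
  exact mem_closure_of_tendsto ht (eventually_nhdsWithin_of_forall fun η hη => h η hη)

/-- Cutting rates off at zero is harmless because the informations are nonnegative. The sum
constraint tolerates the same slack `n * η`, since the cut-off sum is at most `max (R.1 + R.2 - η)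
0`. -/
lemma shrink_mem_rateRegion {A X B : Type*} [Fintype A] [Fintype X] [Fintype B] {n : ℕ}
    (hn : 0 < n) {P : A × X → ℝ} {K : A → X → B → ℝ} (hP : P ∈ stdSimplex ℝ (A × X))
    (hK : ∀ a x, K a x ∈ stdSimplex ℝ B) {R : ℝ × ℝ} (hR₁ : 0 ≤ R.1) (hR₂ : 0 ≤ R.2) {η : ℝ}
    (hη : 0 ≤ η)
    (h₁ : n * R.1 ≤ entropy (joint P K) (fun ω => ω.1) + n * η)
    (h₂ : n * R.2 ≤ condMutualInfo (joint P K) (fun ω => ω.2.1) (fun ω => ω.2.2) (fun ω => ω.1) +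
      n * η)
    (h₁₂ : n * (R.1 + R.2) ≤ mutualInfo (joint P K) (fun ω => (ω.1, ω.2.1)) (fun ω => ω.2.2) +
      n * η) : shrink η R ∈ rateRegion n P K := by
  have hq := joint_mem_stdSimplex hP hK
  have hn' : (0 : ℝ) < n := by exact_mod_cast hn
  have key : ∀ {r t : ℝ}, 0 ≤ t → n * r ≤ t + n * η → max (r - η) 0 ≤ 1 / (n : ℝ) * t := by
    intro r t ht h
    refine max_le ?_ (by positivity)
    rw [one_div, inv_mul_eq_div, le_div_iff₀ hn']
    linarith
  refine ⟨le_max_right _ _, le_max_right _ _, key (entropy_nonneg hq _) h₁,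
    key (condMutualInfo_nonneg hq _ _ _) h₂, le_trans ?_ (key (mutualInfo_nonneg hq _ _) h₁₂)⟩
  simp only [shrink]
  rcases le_total (R.1 - η) 0 with h | h
  · rw [max_eq_right h, zero_add]
    exact max_le_max (by linarith) le_rfl
  · rw [max_eq_left h]
    rcases le_total (R.2 - η) 0 with h' | h'
    · rw [max_eq_right h']
      exact le_max_of_le_left (by linarith)
    · rw [max_eq_left h']
      exact le_max_of_le_left (by linarith)

end Shrink

/-! ### Comparison of the capacity region and the multi-letter regions -/

section Regions

variable {X₁ X₂ Y : Type*} {dmin dmax : ℕ} [Fintype X₁] [Fintype X₂] [Fintype Y]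
  {W : X₁ → X₂ → Y → ℝ}

lemma numMessages_le {n : ℕ} {R : ℝ} (hR : 0 ≤ R) :
    Real.logb 2 (numMessages n R) ≤ n * R + 1 := by
  have h1 : (1 : ℝ) ≤ 2 ^ ((n : ℝ) * R) := Real.one_le_rpow (by norm_num) (by positivity)
  have h2 : (numMessages n R : ℝ) ≤ 2 ^ ((n : ℝ) * R + 1) := by
    rw [Real.rpow_add (by norm_num), Real.rpow_one]
    linarith [numMessages_sub_one_le n R]
  rw [Real.logb_le_iff_le_rpow (by norm_num) (by exact_mod_cast numMessages_pos n R)]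
  exact h2

lemma le_logb_numMessages (n : ℕ) (R : ℝ) : n * R ≤ Real.logb 2 (numMessages n R) := by
  rw [Real.le_logb_iff_rpow_le (by norm_num) (by exact_mod_cast numMessages_pos n R)]
  exact Nat.le_ceil _

/-- Achievable rates lie, up to a vanishing loss, in the region `Ř_n` of any admissible rule. -/
lemma eventually_shrink_mem_regionR (hW : ∀ x₁ x₂, W x₁ x₂ ∈ stdSimplex ℝ Y)
    {S : Set (FillRule X₁ X₂ dmin dmax)} {σ : FillRule X₁ X₂ dmin dmax} (hσ : σ ∈ S)
    {R : ℝ × ℝ} (hR : ACCMACAchievable W S R) {η : ℝ} (hη : 0 < η) :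
    ∀ᶠ n : ℕ in atTop, shrink η R ∈ regionR W σ n := by
  obtain ⟨hR₁, hR₂, c, ε, hε, hc⟩ := hR
  have hlim : Tendsto (fun n : ℕ => 1 / (n : ℝ) + ε n * (R.1 + R.2 + 2)) atTop (𝓝 0) := by
    simpa using (tendsto_one_div_atTop_nhds_zero_nat (𝕜 := ℝ)).add (hε.mul_const (R.1 + R.2 + 2))
  filter_upwards [hlim.eventually_lt_const hη, eventually_gt_atTop 0] with n hn hn0
  have hn' : (1 : ℝ) ≤ n := by exact_mod_cast hn0
  have p₁ := numMessages_pos n R.1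
  have p₂ := numMessages_pos n R.2
  simp only [regionR, Set.mem_iUnion, Set.mem_iInter]
  refine ⟨(c n).inputLaw, (c n).inputLaw_mem_stdSimplex p₁ p₂, fun d => ?_⟩
  obtain ⟨b₁, b₂, b₁₂⟩ := (c n).converse hW p₁ p₂ σ d
  have l₁ := le_logb_numMessages n R.1
  have l₂ := le_logb_numMessages n R.2
  have hΔ : 1 + (c n).errorProb W σ d * Real.logb 2 (numMessages n R.1 * numMessages n R.2) ≤
      n * η := by
    have e₀ := (c n).errorProb_nonneg hW σ d
    have e₁ := hc n d σ hσ
    -- The summand 2 pays for rounding up both message numbers, one bit each, using `1 ≤ n`.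
    have e₂ : Real.logb 2 (numMessages n R.1 * numMessages n R.2) ≤ n * (R.1 + R.2 + 2) := by
      rw [Real.logb_mul (by exact_mod_cast p₁.ne') (by exact_mod_cast p₂.ne')]
      have := numMessages_le (n := n) hR₁
      have := numMessages_le (n := n) hR₂
      nlinarith
    calc _ ≤ 1 + ε n * (n * (R.1 + R.2 + 2)) := by
          refine add_le_add_right ((mul_le_mul_of_nonneg_left e₂ e₀).trans
            (mul_le_mul_of_nonneg_right e₁ (by positivity))) _
      _ = n * (1 / n + ε n * (R.1 + R.2 + 2)) := by field_simp
      _ ≤ n * η := mul_le_mul_of_nonneg_left hn.le (by positivity)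
  refine shrink_mem_rateRegion hn0 ((c n).inputLaw_mem_stdSimplex p₁ p₂)
    (fun x₁ x₂ => transProb_mem_stdSimplex hW σ n d x₁ x₂) hR₁ hR₂ hη.le ?_ ?_ ?_
  · linarith
  · linarith
  · linarith

/-- The joint law of the inputs and the windowed output is the image of the joint law of the
inputs and the whole output. -/
lemma joint_windowTransProb (hW : ∀ x₁ x₂, W x₁ x₂ ∈ stdSimplex ℝ Y)
    (σ : FillRule X₁ X₂ dmin dmax) (n : ℕ) (d : Delay dmin dmax)
    (P : (Fin n → X₁) × (Fin n → X₂) → ℝ) :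
    joint P (windowTransProb W n d) = law (joint P (transProb W σ n d))
      (fun ω => (ω.1, ω.2.1, fun i : Window n dmin dmax => ω.2.2 i.1)) := by
  classical
  refine joint_eq_law (X₁ := fun ω : (Fin n → X₁) × (Fin n → X₂) × (Fin n → Y) => ω.1)
    (X₂ := fun ω => ω.2.1) (Y := fun ω (i : Window n dmin dmax) => ω.2.2 i.1) fun t z => ?_
  obtain ⟨x₁, x₂⟩ := t
  have hsum := sum_joint_mul (P := P) (K := transProb W σ n d)
    fun ω => if ((ω.1, ω.2.1), fun i : Window n dmin dmax => ω.2.2 i.1) = ((x₁, x₂), z)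
      then 1 else 0
  have hlaw : law (joint P (transProb W σ n d))
      (fun ω => ((ω.1, ω.2.1), fun i : Window n dmin dmax => ω.2.2 i.1)) ((x₁, x₂), z) =
      ∑ ω, joint P (transProb W σ n d) ω *
        if ((ω.1, ω.2.1), fun i : Window n dmin dmax => ω.2.2 i.1) = ((x₁, x₂), z)
          then 1 else 0 := by
    simp only [law, mul_ite, mul_one, mul_zero]
    refine Finset.sum_congr rfl fun ω _ => ?_
    split_ifs <;> rfl
  rw [hlaw, hsum, Finset.sum_eq_single x₁, Finset.sum_eq_single x₂]
  · congr 1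
    have h := sum_prod_comp (e := fun i : Window n dmin dmax => i.1) Subtype.val_injective
      (w := fun i : Fin n => W (symbolAt x₁ (σ n d x₁ x₂) ((i : ℤ) - (d : ℤ))) (x₂ i))
      (fun i => (hW _ _).2) (fun z' => if z' = z then 1 else 0)
    have h' : ∑ y, transProb W σ n d x₁ x₂ y *
        (if (fun i : Window n dmin dmax => y i.1) = z then 1 else 0) =
        windowTransProb W n d x₁ x₂ z := by
      refine h.trans ?_
      simp only [mul_ite, mul_one, mul_zero, Finset.sum_ite_eq', Finset.mem_univ, if_true]
      refine Finset.prod_congr rfl fun i _ => ?_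
      have h2 := i.2.1
      have h3 := i.2.2
      have h4 := d.2.1
      have h5 := d.2.2
      have h6 : 0 ≤ ((i.1 : ℕ) : ℤ) - (d : ℤ) ∧ ((i.1 : ℕ) : ℤ) - (d : ℤ) < n := by omega
      rw [symbolAt, dif_pos h6]
      rfl
    rw [← h']
    refine Finset.sum_congr rfl fun y _ => ?_
    simp
  · intro x₂' _ hne
    simp [hne]
  · simp
  · intro x₁' _ hne
    simp [hne]
  · simp

/-- At most `dmax + dmin` times lie outside the window. -/
lemma card_not_window_le (n dmin dmax : ℕ) :
    Fintype.card {i : Fin n // ¬(dmax ≤ (i : ℕ) ∧ (i : ℕ) + dmin < n)} ≤ dmax + dmin := by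
  -- Early times are counted from the start of the block, the remaining ones from its end.
  have h := Fintype.card_le_of_injective
    (fun i : {i : Fin n // ¬(dmax ≤ (i : ℕ) ∧ (i : ℕ) + dmin < n)} =>
      if h : (i.1 : ℕ) < dmax then (Sum.inl ⟨i.1, h⟩ : Fin dmax ⊕ Fin dmin)
      else Sum.inr ⟨n - 1 - i.1, by have := i.2; have := i.1.2; omega⟩) (by
      intro i j hij
      apply Subtype.ext
      apply Fin.ext
      have := i.1.2
      have := j.1.2
      dsimp only at hij
      split_ifs at hij with h₁ h₂ h₂
      · simpa using hij
      · simp only [Sum.inr.injEq, Fin.mk.injEq] at hij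
        omega)
  simpa using h

/-- Restriction to the window is a function of the whole output and leaves the inputs alone, so this
is data processing. -/
lemma window_rateRegion_subset (hW : ∀ x₁ x₂, W x₁ x₂ ∈ stdSimplex ℝ Y)
    (σ : FillRule X₁ X₂ dmin dmax) (n : ℕ) (d : Delay dmin dmax)
    {P : (Fin n → X₁) × (Fin n → X₂) → ℝ}
    (hP : P ∈ stdSimplex ℝ ((Fin n → X₁) × (Fin n → X₂))) :
    rateRegion n P (windowTransProb W n d) ⊆ rateRegion n P (transProb W σ n d) := by
  have hq := joint_mem_stdSimplex hP fun x₁ x₂ => transProb_mem_stdSimplex hW σ n d x₁ x₂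
  have hn : (0 : ℝ) ≤ 1 / n := by positivity
  rintro R ⟨h₁, h₂, h₃, h₄, h₅⟩
  rw [joint_windowTransProb hW σ] at h₃ h₄ h₅
  rw [entropy_law] at h₃
  rw [condMutualInfo_law] at h₄
  rw [mutualInfo_law] at h₅
  refine ⟨h₁, h₂, h₃, h₄.trans (mul_le_mul_of_nonneg_left ?_ hn),
    h₅.trans (mul_le_mul_of_nonneg_left ?_ hn)⟩
  · exact condMutualInfo_comp_le hq _ (fun ω => ω.2.2) _ fun y (i : Window n dmin dmax) => y i.1
  · rw [← condMutualInfo_unit hq, ← condMutualInfo_unit hq]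
    exact condMutualInfo_comp_le hq _ (fun ω => ω.2.2) _ fun y (i : Window n dmin dmax) => y i.1

lemma regionQ_subset_regionR (hW : ∀ x₁ x₂, W x₁ x₂ ∈ stdSimplex ℝ Y)
    (σ : FillRule X₁ X₂ dmin dmax) (n : ℕ) : regionQ W dmin dmax n ⊆ regionR W σ n :=
  Set.iUnion₂_mono fun _ hP => Set.iInter_mono fun d => window_rateRegion_subset hW σ n d hP

/-- The outputs outside the window take at most `|Y| ^ (dmax + dmin)` values, so dropping them costs
at most that many bits in logarithm, whatever symbols the rule supplied. The input law is kept. -/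
lemma shrink_mem_regionQ [Nonempty Y] (hW : ∀ x₁ x₂, W x₁ x₂ ∈ stdSimplex ℝ Y)
    (σ : FillRule X₁ X₂ dmin dmax) {n : ℕ} (hn : 0 < n) {η : ℝ} (hη : 0 ≤ η)
    (hηn : (dmax + dmin : ℕ) * Real.logb 2 (Fintype.card Y) ≤ n * η) {R : ℝ × ℝ}
    (hR : R ∈ regionR W σ n) : shrink η R ∈ regionQ W dmin dmax n := by
  simp only [regionR, regionQ, Set.mem_iUnion, Set.mem_iInter] at hR ⊢
  obtain ⟨P, hP, hR⟩ := hR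
  refine ⟨P, hP, fun d => ?_⟩
  obtain ⟨h₁, h₂, h₃, h₄, h₅⟩ := hR d
  have hq := joint_mem_stdSimplex hP fun x₁ x₂ => transProb_mem_stdSimplex hW σ n d x₁ x₂
  have hn' : (0 : ℝ) < n := by exact_mod_cast hn
  have hY : 0 ≤ Real.logb 2 (Fintype.card Y) :=
    Real.logb_nonneg (by norm_num) (by exact_mod_cast Fintype.card_pos (α := Y))
  have hcard : Real.logb 2 (Fintype.card
      ({i : Fin n // ¬(dmax ≤ (i : ℕ) ∧ (i : ℕ) + dmin < n)} → Y)) ≤ n * η := by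
    refine le_trans ?_ hηn
    rw [Fintype.card_fun]
    push_cast
    rw [Real.logb_pow]
    exact mul_le_mul_of_nonneg_right (by exact_mod_cast card_not_window_le n dmin dmax) hY
  have hfr : ∀ y y' : Fin n → Y, (fun i : Window n dmin dmax => y i.1) = (fun i => y' i.1) →
      (fun i : {i : Fin n // ¬(dmax ≤ (i : ℕ) ∧ (i : ℕ) + dmin < n)} => y i.1) =
        (fun i => y' i.1) → y = y' := by
    intro y y' h h'
    funext i
    by_cases hi : dmax ≤ (i : ℕ) ∧ (i : ℕ) + dmin < n
    · exact congrFun h ⟨i, hi⟩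
    · exact congrFun h' ⟨i, hi⟩
  have key : ∀ {r t : ℝ}, r ≤ 1 / (n : ℝ) * t → n * r ≤ t := fun {r t} h => by
    rw [one_div, inv_mul_eq_div, le_div_iff₀ hn'] at h
    linarith
  refine shrink_mem_rateRegion hn hP (fun x₁ x₂ => windowTransProb_mem_stdSimplex hW n d x₁ x₂)
    h₁ h₂ hη ?_ ?_ ?_ <;> rw [joint_windowTransProb hW σ]
  · rw [entropy_law]
    linarith [key h₃, mul_nonneg hn'.le hη]
  · rw [condMutualInfo_law]
    have := condMutualInfo_le_comp_add hq (fun ω => ω.2.1) (fun ω => ω.2.2) (fun ω => ω.1)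
      (fun y (i : Window n dmin dmax) => y i.1)
      (fun y (i : {i : Fin n // ¬(dmax ≤ (i : ℕ) ∧ (i : ℕ) + dmin < n)}) => y i.1) hfr
    linarith [key h₄]
  · rw [mutualInfo_law]
    have := condMutualInfo_le_comp_add hq (fun ω => (ω.1, ω.2.1)) (fun ω => ω.2.2) (fun _ => ())
      (fun y (i : Window n dmin dmax) => y i.1)
      (fun y (i : {i : Fin n // ¬(dmax ≤ (i : ℕ) ∧ (i : ℕ) + dmin < n)}) => y i.1) hfr
    rw [condMutualInfo_unit hq, condMutualInfo_unit hq] at this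
    linarith [key h₅]

lemma eventually_shrink_mem_regionQ [Nonempty Y] (hW : ∀ x₁ x₂, W x₁ x₂ ∈ stdSimplex ℝ Y)
    (σ : FillRule X₁ X₂ dmin dmax) {η : ℝ} (hη : 0 < η) :
    ∀ᶠ n : ℕ in atTop, ∀ R ∈ regionR W σ n, shrink η R ∈ regionQ W dmin dmax n := by
  have h : Tendsto (fun n : ℕ => (n : ℝ) * η) atTop atTop :=
    tendsto_natCast_atTop_atTop.atTop_mul_const hη
  filter_upwards [h.eventually_ge_atTop ((dmax + dmin : ℕ) * Real.logb 2 (Fintype.card Y)),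
    eventually_gt_atTop 0] with n hn hn0 R hR
  exact shrink_mem_regionQ hW σ hn0 hη.le hn hR

lemma nonneg_of_mem_regionR {σ : FillRule X₁ X₂ dmin dmax} {n : ℕ} {R : ℝ × ℝ}
    (hR : R ∈ regionR W σ n) : 0 ≤ R.1 ∧ 0 ≤ R.2 := by
  simp only [regionR, Set.mem_iUnion, Set.mem_iInter] at hR
  obtain ⟨P, hP, hR⟩ := hR
  -- The sign conditions sit inside the intersection over delays, so some delay is needed; zero
  -- always belongs to the range.
  have h := hR ⟨0, by simp⟩
  exact ⟨h.1, h.2.1⟩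

lemma nonneg_of_mem_regionQ {n : ℕ} {R : ℝ × ℝ} (hR : R ∈ regionQ W dmin dmax n) :
    0 ≤ R.1 ∧ 0 ≤ R.2 := by
  simp only [regionQ, Set.mem_iUnion, Set.mem_iInter] at hR
  obtain ⟨P, hP, hR⟩ := hR
  have h := hR ⟨0, by simp⟩
  exact ⟨h.1, h.2.1⟩

lemma ACCMACAchievable.toACMAC {S : Set (FillRule X₁ X₂ dmin dmax)} {R : ℝ × ℝ}
    (h : ACCMACAchievable W S R) : ACMACAchievable W S R := by
  obtain ⟨h₁, h₂, c, ε, hε, hc⟩ := h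
  exact ⟨h₁, h₂, fun n => (c n).toACMAC, ε, hε, hc⟩

end Regions

end AsyncMAC

/-! ### The cycle of inclusions -/

theorem mainTheorem4 {X₁ X₂ Y : Type*} [Fintype X₁] [Fintype X₂] [Fintype Y]
    [Nonempty X₁] [Nonempty X₂]
    (W : X₁ → X₂ → Y → ℝ) (hW : ∀ x₁ x₂, W x₁ x₂ ∈ stdSimplex ℝ Y)
    (dmin dmax : ℕ)
    (S : Set (AsyncMAC.FillRule X₁ X₂ dmin dmax)) (hS : S.Nonempty)
    (σ : AsyncMAC.FillRule X₁ X₂ dmin dmax) :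
    AsyncMAC.capacityACCMAC W S =
        closure (⋃ n ≥ dmax + dmin + 1, AsyncMAC.regionQ W dmin dmax n) ∧
      AsyncMAC.capacityACCMAC W S =
        closure (limsup (fun n : ℕ => AsyncMAC.regionR W σ n) atTop) ∧
      AsyncMAC.capacityACCMAC W S =
        closure (liminf (fun n : ℕ => AsyncMAC.regionR W σ n) atTop) ∧
      AsyncMAC.capacityACCMAC W S ⊆ AsyncMAC.capacityACMAC W S := by
  have : Nonempty Y := by
    by_contra h
    rw [not_nonempty_iff] at h
    simpa using (hW (Classical.arbitrary X₁) (Classical.arbitrary X₂)).2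
  obtain ⟨σ', hσ'⟩ := hS
  have h₁ : AsyncMAC.capacityACCMAC W S ⊆
      closure (liminf (fun n : ℕ => AsyncMAC.regionR W σ n) atTop) := by
    refine closure_minimal (fun R hR => ?_) isClosed_closure
    refine AsyncMAC.mem_closure_of_shrink_mem hR.1 hR.2.1 fun η hη => ?_
    rw [mem_liminf_iff_eventually_mem]
    -- The converse is available only for a rule `σ'` in `S`. The window region carries the result
    -- over to `σ`: half of `η` pays for Fano's inequality and half for the discarded outputs.
    filter_upwards [AsyncMAC.eventually_shrink_mem_regionR hW hσ' hR (half_pos hη),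
      AsyncMAC.eventually_shrink_mem_regionQ hW σ' (half_pos hη)] with n hn hn'
    have := AsyncMAC.regionQ_subset_regionR hW σ n (hn' _ hn)
    rwa [AsyncMAC.shrink_shrink (half_pos hη).le, add_halves] at this
  have h₂ : closure (liminf (fun n : ℕ => AsyncMAC.regionR W σ n) atTop) ⊆
      closure (limsup (fun n : ℕ => AsyncMAC.regionR W σ n) atTop) :=
    closure_mono liminf_le_limsup
  have h₃ : closure (limsup (fun n : ℕ => AsyncMAC.regionR W σ n) atTop) ⊆
      closure (⋃ n ≥ dmax + dmin + 1, AsyncMAC.regionQ W dmin dmax n) := by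
    refine closure_minimal (fun R hR => ?_) isClosed_closure
    rw [mem_limsup_iff_frequently_mem] at hR
    obtain ⟨n₀, hn₀⟩ := hR.exists
    have h0 := AsyncMAC.nonneg_of_mem_regionR hn₀
    refine AsyncMAC.mem_closure_of_shrink_mem h0.1 h0.2 fun η hη => ?_
    -- Membership for infinitely many `n` meets the eventual passage to the window at some `n` that
    -- is also at least `dmax + dmin + 1`.
    obtain ⟨n, hn, hn', hge⟩ := (hR.and_eventually
      ((AsyncMAC.eventually_shrink_mem_regionQ hW σ hη).and
        (eventually_ge_atTop (dmax + dmin + 1)))).exists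
    exact Set.mem_iUnion₂.2 ⟨n, hge, hn' R hn⟩
  have h₄ : closure (⋃ n ≥ dmax + dmin + 1, AsyncMAC.regionQ W dmin dmax n) ⊆
      AsyncMAC.capacityACCMAC W S := by
    refine closure_minimal (fun R hR => ?_) isClosed_closure
    obtain ⟨n, hn, hR⟩ := Set.mem_iUnion₂.1 hR
    have h0 := AsyncMAC.nonneg_of_mem_regionQ hR
    exact AsyncMAC.mem_closure_of_shrink_mem h0.1 h0.2 fun η hη =>
      AsyncMAC.achievable_of_mem_regionQ hW S (by omega) hR hη
  exact ⟨(h₁.trans (h₂.trans h₃)).antisymm h₄, (h₁.trans h₂).antisymm (h₃.trans h₄),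
    h₁.antisymm (h₂.trans (h₃.trans h₄)), closure_mono fun R hR => hR.toACMAC⟩
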